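/- **Setting.** Let $k \ge 0$ be an integer. Let $\mathcal{L}$ be the set of all primitive lattice segments of slope $0$, $\infty$ and $-1$ in $\mathbb{R}^2$, i.e. the segments joining $p \in \mathbb{Z}^2$ to $p + (1,0)$, $p+(0,1)$ or $p+(1,-1)$. For $A, B \in \mathbb{Z}^2$, an *arc* from $A$ to $B$ is a continuous curve $\gamma : [0,1] \to \mathbb{R}^2$ with $\gamma(0) = A$, $\gamma(1) = B$, such that $\gamma(t) \notin \mathbb{Z}^2$ for $0 < t < 1$, which may intersect itself and which is in minimal position with respect to $\mathcal{L}$: its interior meets $\mathcal{L}$ in finitely many crossings $t_1 < \dots < t_n$, all transversal, where $\gamma$ crosses the segments $\tau_1, \dots, \tau_n$; $\tau_i \ne \tau_{i+1}$ for $1 \le i < n$; and, if $n \geq 1$, $A$ is not an endpoint of $\tau_1$ and $B$ is not an endpoint of $\tau_n$. *The poset $\mathcal{P}_\gamma$.* If $k = 0$, the crossing $i$ contributes one element $a_i$, of weight $1$; put $b_i := a_i$. If $k > 0$, the crossing $i$ contributes two elements $a_i, b_i$, with $a_i \succ b_i$ if $\gamma(t_i)$ is strictly closer to the endpoint of $\tau_i$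 on the right of $\gamma$ than to the one on the left, and $a_i \prec b_i$ otherwise; the smaller of the two has weight $k$ and the larger has weight $\frac1k$. For $1 \le i < n$ put $b_i \succ a_{i+1}$ if $\tau_i$ and $\tau_{i+1}$ share an endpoint on the right of $\gamma$, and $b_i \prec a_{i+1}$ otherwise. $\mathcal{P}_\gamma$ is the weighted poset generated by these relations (empty if $n = 0$). The *$k$-Markov length* of $\gamma$ is $$\ell_k(\gamma) = \sum_{I} \prod_{\rho \in I} w(\rho),$$ where $I$ runs over all order ideals (down-closed subsets) of $\mathcal{P}_\gamma$ and $w$ is the weight. The *$k$-Markov distance* is $|AB|_k = 0$ if $A = B$, and $|AB|_k = \min_\delta \ell_k(\delta)$ if $A \ne B$, where $\delta$ ranges over all arcs with endpoints $A$ and $B$, oriented either way. **Lemma.** Let $\gamma$ be an arc from $A$ to $B$ with a non-contractible self-intersection, that is, there are $0 < s < t < 1$ with $\gamma(s) = \gamma(t)$ such that the loop $\gamma|_{[s,t]}$ is not contractible in $\mathbb{R}^2 \setminus \mathbb{Z}^2$. Then (if $A \neq B$, the minimum defining $|AB|_k$ is attained, and) $$\ell_k(\gamma) > |AB|_k .$$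 -/

import Mathlib

open Set Filter Topology

noncomputable section

/-! ### Weighted fence posets -/

/-- A weighted fence poset with chronological labelling `P(0), …, P(size - 1)`: neighbouring
elements satisfy `P(i) ≺ P(i+1)` if `Ascends i` holds and `P(i) ≻ P(i+1)` otherwise.
Only the values of `Ascends` and `weight` at indices in range matter. -/
structure WeightedFence where
  size : ℕ
  Ascends : ℕ → Prop
  weight : ℕ → ℝ

namespace WeightedFence

/-- The elements of the fence. -/
def Elem (P : WeightedFence) : Type := Fin P.size

/-- The position of an element in the chronological labelling. -/
def Elem.idx {P : WeightedFence} (x : P.Elem) : ℕ := Fin.val x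

instance (P : WeightedFence) : Fintype P.Elem := inferInstanceAs (Fintype (Fin P.size))

instance (P : WeightedFence) : DecidableEq P.Elem := inferInstanceAs (DecidableEq (Fin P.size))

/-- The relations between neighbours of the fence: `x` lies directly below `y`. -/
def Below (P : WeightedFence) (x y : P.Elem) : Prop :=
  (y.idx = x.idx + 1 ∧ P.Ascends x.idx) ∨ (x.idx = y.idx + 1 ∧ ¬ P.Ascends y.idx)

theorem le_char (P : WeightedFence) {x y : P.Elem} (h : Relation.ReflTransGen P.Below x y) :
    (x.idx ≤ y.idx ∧ ∀ i, x.idx ≤ i → i < y.idx → P.Ascends i) ∨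
      (y.idx ≤ x.idx ∧ ∀ i, y.idx ≤ i → i < x.idx → ¬ P.Ascends i) := by
  induction h with
  | refl => left; exact ⟨le_rfl, fun i h1 h2 => absurd h2 (by omega)⟩
  | tail _ hb ih =>
    unfold Below at hb
    grind

/-- The fence poset: the partial order generated by the relations between neighbours. -/
instance (P : WeightedFence) : PartialOrder P.Elem where
  le := Relation.ReflTransGen P.Below
  le_refl _ := Relation.ReflTransGen.refl
  le_trans _ _ _ := Relation.ReflTransGen.trans
  le_antisymm x y hxy hyx := by
    have h1 := P.le_char hxy
    have h2 := P.le_char hyx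
    have h3 : x.idx = y.idx := by
      rcases h1 with ⟨a, b⟩ | ⟨a, b⟩ <;> rcases h2 with ⟨c, d⟩ | ⟨c, d⟩
      · omega
      · by_contra hne
        exact d x.idx le_rfl (by omega) (b x.idx le_rfl (by omega))
      · by_contra hne
        exact b y.idx le_rfl (by omega) (d y.idx le_rfl (by omega))
      · omega
    exact Fin.ext h3

open Classical in
/-- `𝒲(P)`: the sum over all order ideals `I` of `P` of the product of the weights of the
elements of `I`. -/
def weightSum (P : WeightedFence) : ℝ :=
  ∑ I ∈ (Finset.univ : Finset (Finset P.Elem)).filter (fun I => IsLowerSet (I : Set P.Elem)),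
    ∏ x ∈ I, P.weight x.idx

end WeightedFence

/-! ### Arcs on the integer lattice -/

/-- The Euclidean plane. -/
abbrev Plane : Type := EuclideanSpace ℝ (Fin 2)

/-- An integral point, as a point of the plane. -/
def latticePt (p : ℤ × ℤ) : Plane := !₂[(p.1 : ℝ), (p.2 : ℝ)]

/-- `p` and `q` are the endpoints of a primitive lattice segment of slope `0`, `∞` or `-1`. -/
def IsLatticeEdge (p q : ℤ × ℤ) : Prop :=
  q - p ∈ ({(1, 0), (-1, 0), (0, 1), (0, -1), (1, -1), (-1, 1)} : Set (ℤ × ℤ))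

/-- The union of all primitive lattice segments of slope `0`, `∞` and `-1`. -/
def latticeGrid : Set Plane :=
  {x | ∃ p q, IsLatticeEdge p q ∧ x ∈ segment ℝ (latticePt p) (latticePt q)}

/-- The side of the line through `l` and `r` on which `x` lies: for an observer who crosses this
line with `l` on the left and `r` on the right, it is negative behind the line and positive
beyond it. -/
def sideOf (l r : ℤ × ℤ) (x : Plane) : ℝ :=
  ((r.1 : ℝ) - l.1) * (x 1 - l.2) - ((r.2 : ℝ) - l.2) * (x 0 - l.1)

/-- An oriented arc from `A` to `B`: a curve in the plane, parametrised by `[0, 1]`, whose interior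
avoids the integral points and which is in minimal position with respect to the lattice segments
of slope `0`, `∞` and `-1`. Self-intersections are allowed.

The arc meets the segments transversally at finitely many times `time 0 < time 1 < ⋯`; the `i`-th
segment crossed has the endpoint `left i` on the left and the endpoint `right i` on the right of
the arc. The values of `curve` outside `[0, 1]` and those of `time`, `left`, `right` at indices
`≥ numCrossings` are irrelevant; all other data are determined by the curve. -/
structure LatticeArc (A B : ℤ × ℤ) where
  curve : ℝ → Plane
  continuousOn_curve : ContinuousOn curve (Icc 0 1)
  curve_zero : curve 0 = latticePt A
  curve_one : curve 1 = latticePt B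
  curve_avoids : ∀ t ∈ Ioo (0 : ℝ) 1, curve t ∉ range latticePt
  numCrossings : ℕ
  time : ℕ → ℝ
  left : ℕ → ℤ × ℤ
  right : ℕ → ℤ × ℤ
  /-- The crossings are listed in the order in which they occur. -/
  time_lt_time : ∀ i j, i < j → j < numCrossings → time i < time j
  /-- The crossings are exactly the interior intersections with the lattice segments. -/
  crossing_times : ∀ t ∈ Ioo (0 : ℝ) 1,
    (curve t ∈ latticeGrid ↔ ∃ i < numCrossings, time i = t)
  time_mem : ∀ i < numCrossings, time i ∈ Ioo (0 : ℝ) 1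
  isLatticeEdge : ∀ i < numCrossings, IsLatticeEdge (left i) (right i)
  curve_time_mem : ∀ i < numCrossings,
    curve (time i) ∈ openSegment ℝ (latticePt (left i)) (latticePt (right i))
  /-- Transversality: at each crossing the arc passes from one side to the other. -/
  side_before : ∀ i < numCrossings, ∀ᶠ t in 𝓝[<] (time i), sideOf (left i) (right i) (curve t) < 0
  side_after : ∀ i < numCrossings, ∀ᶠ t in 𝓝[>] (time i), 0 < sideOf (left i) (right i) (curve t)
  /-- Minimality: no segment is crossed twice in a row (no bigons), … -/
  no_bigon : ∀ i, i + 1 < numCrossings → s(left i, right i) ≠ s(left (i + 1), right (i + 1))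
  /-- … and neither the first nor the last segment crossed ends at the endpoint of the arc next
  to it (no half-bigons). -/
  first_crossing : 0 < numCrossings → A ∉ s(left 0, right 0)
  last_crossing : ∀ i, i + 1 = numCrossings → B ∉ s(left i, right i)

namespace LatticeArc

variable {A B : ℤ × ℤ}

/-- The segments crossed at steps `i` and `i + 1` share an endpoint on the right of the arc. -/
def SharesRight (γ : LatticeArc A B) (i : ℕ) : Prop := γ.right i = γ.right (i + 1)

/-- The `i`-th crossing is strictly closer to the right endpoint of the segment crossed than to
its left endpoint. -/
def CloserToRight (γ : LatticeArc A B) (i : ℕ) : Prop :=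
  dist (γ.curve (γ.time i)) (latticePt (γ.right i)) <
    dist (γ.curve (γ.time i)) (latticePt (γ.left i))

open Classical in
/-- The weighted fence poset `P_γ` of the arc `γ`. For `k = 0` every crossing contributes one
element, of weight `1`. For `k > 0` the crossing `i` contributes the two elements `2 * i` and
`2 * i + 1`; the smaller one has weight `k` and the larger one has weight `1 / k`. -/
def fence (k : ℕ) (γ : LatticeArc A B) : WeightedFence :=
  if k = 0 then
    { size := γ.numCrossings
      Ascends := fun j => ¬ γ.SharesRight j
      weight := fun _ => 1 }
  else
    { size := 2 * γ.numCrossings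
      Ascends := fun j =>
        if j % 2 = 0 then ¬ γ.CloserToRight (j / 2) else ¬ γ.SharesRight (j / 2)
      weight := fun j =>
        if j % 2 = 0 then
          if γ.CloserToRight (j / 2) then 1 / (k : ℝ) else (k : ℝ)
        else
          if γ.CloserToRight (j / 2) then (k : ℝ) else 1 / (k : ℝ) }

/-- The `k`-Markov length `ℓ_k(γ) = 𝒲(P_γ)`. -/
def markovLength (k : ℕ) (γ : LatticeArc A B) : ℝ := (γ.fence k).weightSum

/-- The plane with the integral points removed. -/
abbrev PuncturedPlane : Type := {x : Plane // x ∉ range latticePt}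

/-- The arc passes twice through a point, at interior times `s < t`, and the loop that it
describes in between is not contractible in the plane with the integral points removed. -/
def HasNoncontractibleSelfIntersection (γ : LatticeArc A B) : Prop :=
  ∃ s t : ℝ, 0 < s ∧ s < t ∧ t < 1 ∧
    ∃ (C : PuncturedPlane) (loop : Path C C),
      (∀ u : unitInterval, (loop u : Plane) = γ.curve (s + (u : ℝ) * (t - s))) ∧
      ¬ loop.Homotopic (Path.refl C)

end LatticeArc

/-- The `k`-Markov lengths of all arcs with endpoints `A` and `B`, oriented either way. -/
def markovLengths (k : ℕ) (A B : ℤ × ℤ) : Set ℝ :=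
  range (fun δ : LatticeArc A B => δ.markovLength k) ∪
    range (fun δ : LatticeArc B A => δ.markovLength k)

open Classical in
/-- The `k`-Markov distance `|AB|_k`: zero if `A = B`, and otherwise the minimum of the `k`-Markov
lengths of the arcs with endpoints `A` and `B`. -/
def markovDistance (k : ℕ) (A B : ℤ × ℤ) : ℝ :=
  if A = B then 0 else sInf (markovLengths k A B)

end

/-!
An arc is governed by the sequence of triangles that it visits: the lattice segments cut the plane
into triangles, and between two crossings an arc stays inside one of them. Minimal position makes
this sequence non-backtracking, so that each segment crossed is one of the two other sides of the
triangle entered through the previous one (`LatticeArc.step`), while the endpoints of the arc are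
the vertices opposite to the first and to the last segment crossed (`LatticeArc.start_eq_apex`,
`LatticeArc.end_eq_apex`).

Let the arc have a self-intersection. If no crossing took place in the loop, then the loop would be
contained in a triangle and hence be contractible. So the arc visits some triangle twice
(`LatticeArc.exists_label_eq`). Leaving out the crossings in between, and further ones as long as
the remaining sequence backtracks or passes by an endpoint of the arc, gives a sequence of crossings
in minimal position (`LatticeArc.exists_shorter_of_label_eq`). Straight segments between the old
crossing points, which remain in place, realize it by an arc with the same endpoints
(`exists_latticeArc`). The sequence becomes empty only if the endpoints are neighbours, and then
they are joined by an arc without crossings.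

The new arc is shorter (`LatticeArc.markovLength_lt_of_removal`). Its fence is obtained from the old
one by removing consecutive elements, with a new relation between the two neighbours of the gap.
If the new relation comes from a common endpoint on the right, then one of the old relations between
segments in the gap does as well: otherwise the old arc would turn around a fixed point on its left,
and the two segments next to the gap would have both endpoints in common. The same holds with left
and right exchanged. Cutting the gap at such a relation and collapsing both parts to the neighbours
of the gap defines a monotone retraction of the old fence onto the new one. Taking preimages embeds
the order ideals of the new fence into those of the old one, preserving weights, because the two
elements that come from one crossing have reciprocal weights; and some order ideal is missed
(`WeightedFence.weightSum_lt_of_retract`).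

The minimum is attained since all Markov lengths are natural numbers. If the two endpoints coincide,
then the distance is zero, while Markov lengths are positive.
-/

/-! ### The triangles of the lattice -/

@[simp] theorem latticePt_apply_zero (p : ℤ × ℤ) : latticePt p 0 = p.1 := by
  simp [latticePt]

@[simp] theorem latticePt_apply_one (p : ℤ × ℤ) : latticePt p 1 = p.2 := by
  simp [latticePt]

theorem Plane.ext_coord {x y : Plane} (h0 : x 0 = y 0) (h1 : x 1 = y 1) : x = y := by
  ext i
  fin_cases i
  · exact h0
  · exact h1

theorem continuous_sideOf (l r : ℤ × ℤ) : Continuous (sideOf l r) := by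
  unfold sideOf
  fun_prop

theorem sideOf_swap (l r : ℤ × ℤ) (x : Plane) : sideOf r l x = -sideOf l r x := by
  unfold sideOf
  ring

/-- `sideOf l r` is an affine function. -/
theorem sideOf_combo (l r : ℤ × ℤ) (x y : Plane) {a b : ℝ} (h : a + b = 1) :
    sideOf l r (a • x + b • y) = a * sideOf l r x + b * sideOf l r y := by
  obtain rfl : b = 1 - a := by linarith
  simp [sideOf]
  ring

/-- The six possible values of the second endpoint of a lattice edge. -/
theorem IsLatticeEdge.cases {l r : ℤ × ℤ} (h : IsLatticeEdge l r) :
    r = (l.1 + 1, l.2) ∨ r = (l.1 - 1, l.2) ∨ r = (l.1, l.2 + 1) ∨ r = (l.1, l.2 - 1) ∨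
      r = (l.1 + 1, l.2 - 1) ∨ r = (l.1 - 1, l.2 + 1) := by
  obtain ⟨a, b⟩ := l
  obtain ⟨c, d⟩ := r
  simp only [IsLatticeEdge, mem_insert_iff, mem_singleton_iff, Prod.mk_sub_mk,
    Prod.mk.injEq] at h ⊢
  omega

theorem isLatticeEdge_iff {l r : ℤ × ℤ} : IsLatticeEdge l r ↔
    r = (l.1 + 1, l.2) ∨ r = (l.1 - 1, l.2) ∨ r = (l.1, l.2 + 1) ∨ r = (l.1, l.2 - 1) ∨
      r = (l.1 + 1, l.2 - 1) ∨ r = (l.1 - 1, l.2 + 1) := by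
  refine ⟨IsLatticeEdge.cases, fun h => ?_⟩
  obtain ⟨a, b⟩ := l
  obtain ⟨c, d⟩ := r
  simp only [IsLatticeEdge, mem_insert_iff, mem_singleton_iff, Prod.mk_sub_mk,
    Prod.mk.injEq] at h ⊢
  omega

theorem IsLatticeEdge.symm {l r : ℤ × ℤ} (h : IsLatticeEdge l r) : IsLatticeEdge r l := by
  rw [isLatticeEdge_iff] at *
  simp only [Prod.ext_iff] at *
  omega

theorem IsLatticeEdge.ne {l r : ℤ × ℤ} (h : IsLatticeEdge l r) : l ≠ r := by
  rw [isLatticeEdge_iff] at h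
  simp only [Ne, Prod.ext_iff] at *
  omega

/-- The third vertex of the triangle beyond the edge from `l` to `r`, for an observer who crosses
it with `l` on the left and `r` on the right: `l, r, apex l r` is the counterclockwise order. -/
def apex (l r : ℤ × ℤ) : ℤ × ℤ := (l.1 + l.2 - r.2, r.1 + r.2 - l.1)

@[simp] theorem apex_right_apex (l r : ℤ × ℤ) : apex r (apex l r) = l := by
  ext <;> simp only [apex] <;> ring

@[simp] theorem apex_apex_left (l r : ℤ × ℤ) : apex (apex l r) l = r := by
  ext <;> simp only [apex] <;> ring

theorem IsLatticeEdge.right_apex {l r : ℤ × ℤ} (h : IsLatticeEdge l r) :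
    IsLatticeEdge r (apex l r) := by
  rw [isLatticeEdge_iff] at *
  simp only [Prod.ext_iff, apex] at *
  omega

theorem IsLatticeEdge.apex_left {l r : ℤ × ℤ} (h : IsLatticeEdge l r) :
    IsLatticeEdge (apex l r) l := by
  simpa using h.right_apex.right_apex

theorem IsLatticeEdge.apex_notMem {l r : ℤ × ℤ} (h : IsLatticeEdge l r) :
    apex l r ∉ s(l, r) := by
  rw [Sym2.mem_iff]
  rintro (h1 | h1)
  · exact h.apex_left.ne h1
  · exact h.right_apex.ne h1.symm

/-- The open triangle beyond the edge from `l` to `r`. -/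
def openTriangle (l r : ℤ × ℤ) : Set Plane :=
  {x | 0 < sideOf l r x ∧ 0 < sideOf r (apex l r) x ∧ 0 < sideOf (apex l r) l x}

/-- The closed triangle beyond the edge from `l` to `r`. -/
def closedTriangle (l r : ℤ × ℤ) : Set Plane :=
  {x | 0 ≤ sideOf l r x ∧ 0 ≤ sideOf r (apex l r) x ∧ 0 ≤ sideOf (apex l r) l x}

/-- The sum of the three vertices of the triangle beyond the edge from `l` to `r`. It determines
the triangle and serves as a label for it. -/
def triSum (l r : ℤ × ℤ) : ℤ × ℤ := l + r + apex l r

theorem openTriangle_rotate (l r : ℤ × ℤ) : openTriangle r (apex l r) = openTriangle l r := by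
  ext x
  simp only [openTriangle, mem_ofPred_eq, apex_right_apex]
  tauto

theorem closedTriangle_rotate (l r : ℤ × ℤ) :
    closedTriangle r (apex l r) = closedTriangle l r := by
  ext x
  simp only [closedTriangle, mem_ofPred_eq, apex_right_apex]
  tauto

theorem openTriangle_subset_closedTriangle (l r : ℤ × ℤ) :
    openTriangle l r ⊆ closedTriangle l r :=
  fun _ h => ⟨h.1.le, h.2.1.le, h.2.2.le⟩

theorem isOpen_openTriangle (l r : ℤ × ℤ) : IsOpen (openTriangle l r) :=
  (isOpen_lt continuous_const (continuous_sideOf _ _)).inter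
    ((isOpen_lt continuous_const (continuous_sideOf _ _)).inter
      (isOpen_lt continuous_const (continuous_sideOf _ _)))

theorem isClosed_closedTriangle (l r : ℤ × ℤ) : IsClosed (closedTriangle l r) :=
  (isClosed_le continuous_const (continuous_sideOf _ _)).inter
    ((isClosed_le continuous_const (continuous_sideOf _ _)).inter
      (isClosed_le continuous_const (continuous_sideOf _ _)))

/-- The three functions `sideOf` along the sides of a triangle are its barycentric coordinates. -/
theorem IsLatticeEdge.sideOf_add {l r : ℤ × ℤ} (h : IsLatticeEdge l r) (x : Plane) :
    sideOf l r x + sideOf r (apex l r) x + sideOf (apex l r) l x = 1 := by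
  obtain ⟨a, b⟩ := l
  rcases h.cases with rfl | rfl | rfl | rfl | rfl | rfl <;>
  · simp only [sideOf, apex]
    push_cast
    ring

/-- If at every side of a triangle one of two points of the closed triangle is off that side,
then the open segment between them lies in the open triangle. -/
theorem openSegment_subset_openTriangle {l r : ℤ × ℤ} {x y : Plane}
    (hx : x ∈ closedTriangle l r) (hy : y ∈ closedTriangle l r)
    (h1 : 0 < sideOf l r x ∨ 0 < sideOf l r y)
    (h2 : 0 < sideOf r (apex l r) x ∨ 0 < sideOf r (apex l r) y)
    (h3 : 0 < sideOf (apex l r) l x ∨ 0 < sideOf (apex l r) l y) :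
    openSegment ℝ x y ⊆ openTriangle l r := by
  rintro _ ⟨a, b, ha, hb, hab, rfl⟩
  have key : ∀ p q : ℤ × ℤ, 0 ≤ sideOf p q x → 0 ≤ sideOf p q y →
      (0 < sideOf p q x ∨ 0 < sideOf p q y) → 0 < sideOf p q (a • x + b • y) := by
    intro p q hx hy h
    rw [sideOf_combo _ _ _ _ hab]
    rcases h with h | h <;> positivity
  exact ⟨key _ _ hx.1 hy.1 h1, key _ _ hx.2.1 hy.2.1 h2, key _ _ hx.2.2 hy.2.2 h3⟩

theorem convex_openTriangle (l r : ℤ × ℤ) : Convex ℝ (openTriangle l r) := by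
  rw [convex_iff_openSegment_subset]
  intro x hx y hy
  exact openSegment_subset_openTriangle (openTriangle_subset_closedTriangle _ _ hx)
    (openTriangle_subset_closedTriangle _ _ hy) (Or.inl hx.1) (Or.inl hx.2.1) (Or.inl hx.2.2)

/-- Every triangle is a lower left or an upper right half of a unit square, and its label tells
which one. -/
theorem IsLatticeEdge.triangle_cases {l r : ℤ × ℤ} (h : IsLatticeEdge l r) :
    ∃ m n : ℤ,
      (triSum l r = (3 * m + 1, 3 * n + 1) ∧
        (∀ x, x ∈ openTriangle l r ↔ m < x 0 ∧ n < x 1 ∧ x 0 + x 1 < m + n + 1) ∧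
        (∀ x, x ∈ closedTriangle l r ↔ m ≤ x 0 ∧ n ≤ x 1 ∧ x 0 + x 1 ≤ m + n + 1)) ∨
      (triSum l r = (3 * m + 2, 3 * n + 2) ∧
        (∀ x, x ∈ openTriangle l r ↔ x 0 < m + 1 ∧ x 1 < n + 1 ∧ m + n + 1 < x 0 + x 1) ∧
        (∀ x, x ∈ closedTriangle l r ↔ x 0 ≤ m + 1 ∧ x 1 ≤ n + 1 ∧ m + n + 1 ≤ x 0 + x 1)) := by
  obtain ⟨a, b⟩ := l
  rcases h.cases with rfl | rfl | rfl | rfl | rfl | rfl <;>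
  [refine ⟨a, b, Or.inl ⟨?_, fun x => ?_, fun x => ?_⟩⟩;
    refine ⟨a - 1, b - 1, Or.inr ⟨?_, fun x => ?_, fun x => ?_⟩⟩;
    refine ⟨a - 1, b, Or.inr ⟨?_, fun x => ?_, fun x => ?_⟩⟩;
    refine ⟨a, b - 1, Or.inl ⟨?_, fun x => ?_, fun x => ?_⟩⟩;
    refine ⟨a, b - 1, Or.inr ⟨?_, fun x => ?_, fun x => ?_⟩⟩;
    refine ⟨a - 1, b, Or.inl ⟨?_, fun x => ?_, fun x => ?_⟩⟩] <;>
  first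
  | simp only [triSum, apex, Prod.ext_iff, Prod.fst_add, Prod.snd_add]
    omega
  | simp only [openTriangle, closedTriangle, sideOf, apex, mem_ofPred_eq]
    push_cast
    constructor <;> rintro ⟨h1, h2, h3⟩ <;> refine ⟨?_, ?_, ?_⟩ <;> linarith

/-! ### The grid and its complement -/

theorem mem_segment_lattice_iff {p q : ℤ × ℤ} {x : Plane} :
    x ∈ segment ℝ (latticePt p) (latticePt q) ↔
      ∃ θ : ℝ, 0 ≤ θ ∧ θ ≤ 1 ∧ x 0 = p.1 + θ * (q.1 - p.1) ∧ x 1 = p.2 + θ * (q.2 - p.2) := by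
  constructor
  · rintro ⟨a, b, ha, hb, hab, rfl⟩
    obtain rfl : a = 1 - b := by linarith
    refine ⟨b, hb, by linarith, ?_, ?_⟩ <;> simp <;> ring
  · rintro ⟨θ, h0, h1, hx0, hx1⟩
    refine ⟨1 - θ, θ, by linarith, h0, by ring, Plane.ext_coord ?_ ?_⟩
    · simp [hx0]; ring
    · simp [hx1]; ring

theorem mem_openSegment_lattice_iff {p q : ℤ × ℤ} {x : Plane} :
    x ∈ openSegment ℝ (latticePt p) (latticePt q) ↔
      ∃ θ : ℝ, 0 < θ ∧ θ < 1 ∧ x 0 = p.1 + θ * (q.1 - p.1) ∧ x 1 = p.2 + θ * (q.2 - p.2) := by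
  constructor
  · rintro ⟨a, b, ha, hb, hab, rfl⟩
    obtain rfl : a = 1 - b := by linarith
    refine ⟨b, hb, by linarith, ?_, ?_⟩ <;> simp <;> ring
  · rintro ⟨θ, h0, h1, hx0, hx1⟩
    refine ⟨1 - θ, θ, by linarith, h0, by ring, Plane.ext_coord ?_ ?_⟩
    · simp [hx0]; ring
    · simp [hx1]; ring

/-- The grid consists of the points with an integral value of `x`, `y` or `x + y`. -/
theorem mem_latticeGrid_iff {x : Plane} : x ∈ latticeGrid ↔
    (∃ m : ℤ, x 0 = m) ∨ (∃ m : ℤ, x 1 = m) ∨ (∃ m : ℤ, x 0 + x 1 = m) := by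
  constructor
  · rintro ⟨⟨a, b⟩, q, hpq, hx⟩
    obtain ⟨θ, -, -, h0, h1⟩ := mem_segment_lattice_iff.1 hx
    rcases hpq.cases with rfl | rfl | rfl | rfl | rfl | rfl
    · exact Or.inr (Or.inl ⟨b, by simpa using h1⟩)
    · exact Or.inr (Or.inl ⟨b, by simpa using h1⟩)
    · exact Or.inl ⟨a, by simpa using h0⟩
    · exact Or.inl ⟨a, by simpa using h0⟩
    · refine Or.inr (Or.inr ⟨a + b, ?_⟩)
      push_cast at h0 h1 ⊢
      linarith
    · refine Or.inr (Or.inr ⟨a + b, ?_⟩)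
      push_cast at h0 h1 ⊢
      linarith
  · have f0 := Int.floor_le (x 0)
    have f0' := (Int.lt_floor_add_one (x 0)).le
    have f1 := Int.floor_le (x 1)
    have f1' := (Int.lt_floor_add_one (x 1)).le
    rintro (⟨m, hm⟩ | ⟨m, hm⟩ | ⟨m, hm⟩)
    · refine ⟨(m, ⌊x 1⌋), (m, ⌊x 1⌋ + 1), isLatticeEdge_iff.2 (by simp), ?_⟩
      refine mem_segment_lattice_iff.2 ⟨x 1 - ⌊x 1⌋, by linarith, by linarith, ?_, ?_⟩
      · simp [hm]
      · simp
    · refine ⟨(⌊x 0⌋, m), (⌊x 0⌋ + 1, m), isLatticeEdge_iff.2 (by simp), ?_⟩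
      refine mem_segment_lattice_iff.2 ⟨x 0 - ⌊x 0⌋, by linarith, by linarith, ?_, ?_⟩
      · simp
      · simp [hm]
    · refine ⟨(⌊x 0⌋, m - ⌊x 0⌋), (⌊x 0⌋ + 1, m - ⌊x 0⌋ - 1), isLatticeEdge_iff.2 (by simp), ?_⟩
      refine mem_segment_lattice_iff.2 ⟨x 0 - ⌊x 0⌋, by linarith, by linarith, ?_, ?_⟩
      · simp
      · push_cast
        linarith

theorem IsLatticeEdge.openSegment_subset_latticeGrid {p q : ℤ × ℤ} (h : IsLatticeEdge p q) :
    openSegment ℝ (latticePt p) (latticePt q) ⊆ latticeGrid :=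
  fun _ hx => ⟨p, q, h, openSegment_subset_segment _ _ _ hx⟩

theorem latticePt_mem_latticeGrid (p : ℤ × ℤ) : latticePt p ∈ latticeGrid :=
  mem_latticeGrid_iff.2 (Or.inl ⟨p.1, by simp⟩)

theorem not_int_of_between {y : ℝ} {m n : ℤ} (h1 : (m : ℝ) < y) (h2 : y < m + 1) : y ≠ n := by
  rintro rfl
  have h1 : m < n := by exact_mod_cast h1
  have h2 : n < m + 1 := by exact_mod_cast h2
  omega

theorem notMem_latticeGrid_of_mem_openTriangle {l r : ℤ × ℤ} (h : IsLatticeEdge l r) {x : Plane}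
    (hx : x ∈ openTriangle l r) : x ∉ latticeGrid := by
  rw [mem_latticeGrid_iff]
  obtain ⟨m, n, ⟨-, h1, -⟩ | ⟨-, h1, -⟩⟩ := h.triangle_cases <;>
    obtain ⟨a1, a2, a3⟩ := (h1 x).1 hx
  · rintro (⟨i, hi⟩ | ⟨i, hi⟩ | ⟨i, hi⟩)
    · exact not_int_of_between a1 (by linarith) hi
    · exact not_int_of_between a2 (by linarith) hi
    · exact not_int_of_between (m := m + n) (by push_cast; linarith) (by push_cast; linarith) hi
  · rintro (⟨i, hi⟩ | ⟨i, hi⟩ | ⟨i, hi⟩)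
    · exact not_int_of_between (m := m) (by linarith) a1 hi
    · exact not_int_of_between (m := n) (by linarith) a2 hi
    · exact not_int_of_between (m := m + n + 1) (by push_cast; linarith)
        (by push_cast; linarith) hi

theorem mem_openTriangle_of_mem_closedTriangle {l r : ℤ × ℤ} (h : IsLatticeEdge l r) {x : Plane}
    (hx : x ∈ closedTriangle l r) (hg : x ∉ latticeGrid) : x ∈ openTriangle l r := by
  rw [mem_latticeGrid_iff] at hg
  push Not at hg
  obtain ⟨g1, g2, g3⟩ := hg
  obtain ⟨m, n, ⟨-, h1, h2⟩ | ⟨-, h1, h2⟩⟩ := h.triangle_cases <;>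
    obtain ⟨a1, a2, a3⟩ := (h2 x).1 hx
  · exact (h1 x).2 ⟨lt_of_le_of_ne a1 (g1 m).symm, lt_of_le_of_ne a2 (g2 n).symm,
      lt_of_le_of_ne a3 (by simpa using g3 (m + n + 1))⟩
  · exact (h1 x).2 ⟨lt_of_le_of_ne a1 (by simpa using g1 (m + 1)),
      lt_of_le_of_ne a2 (by simpa using g2 (n + 1)),
      lt_of_le_of_ne a3 (by simpa using (g3 (m + n + 1)).symm)⟩

theorem exists_mem_openTriangle {x : Plane} (hx : x ∉ latticeGrid) :
    ∃ l r, IsLatticeEdge l r ∧ x ∈ openTriangle l r := by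
  rw [mem_latticeGrid_iff] at hx
  push Not at hx
  obtain ⟨g1, g2, g3⟩ := hx
  have f0 := lt_of_le_of_ne (Int.floor_le (x 0)) (g1 _).symm
  have f0' := Int.lt_floor_add_one (x 0)
  have f1 := lt_of_le_of_ne (Int.floor_le (x 1)) (g2 _).symm
  have f1' := Int.lt_floor_add_one (x 1)
  generalize ⌊x 0⌋ = m at *
  generalize ⌊x 1⌋ = n at *
  rcases lt_or_gt_of_ne (g3 (m + n + 1)) with h | h <;> push_cast at h
  · refine ⟨(m, n), (m + 1, n), isLatticeEdge_iff.2 (by simp), ?_⟩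
    simp only [openTriangle, sideOf, apex, mem_ofPred_eq]
    push_cast
    refine ⟨?_, ?_, ?_⟩ <;> linarith
  · refine ⟨(m + 1, n + 1), (m, n + 1), isLatticeEdge_iff.2 (by simp), ?_⟩
    simp only [openTriangle, sideOf, apex, mem_ofPred_eq]
    push_cast
    refine ⟨?_, ?_, ?_⟩ <;> linarith

/-- Off the grid, the triangles are open and closed. -/
theorem IsPreconnected.subset_openTriangle {S : Set Plane} (hS : IsPreconnected S)
    (hg : ∀ x ∈ S, x ∉ latticeGrid) {l r : ℤ × ℤ} (h : IsLatticeEdge l r)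
    (hne : (S ∩ openTriangle l r).Nonempty) : S ⊆ openTriangle l r := by
  refine hS.subset_left_of_subset_union (isOpen_openTriangle l r)
    (isClosed_closedTriangle l r).isOpen_compl ?_ ?_ hne
  · exact Set.disjoint_compl_right_iff_subset.2 (openTriangle_subset_closedTriangle l r)
  · intro x hx
    by_cases hc : x ∈ closedTriangle l r
    · exact Or.inl (mem_openTriangle_of_mem_closedTriangle h hc (hg x hx))
    · exact Or.inr hc

/-- The label of a triangle is determined by any of its interior points. -/
theorem triSum_eq_of_mem {l r l' r' : ℤ × ℤ} (h : IsLatticeEdge l r) (h' : IsLatticeEdge l' r')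
    {x : Plane} (hx : x ∈ openTriangle l r) (hx' : x ∈ openTriangle l' r') :
    triSum l r = triSum l' r' := by
  have key : ∀ {l r : ℤ × ℤ}, IsLatticeEdge l r → x ∈ openTriangle l r →
      triSum l r = (2 * ⌊x 0⌋ - ⌊x 1⌋ + ⌊x 0 + x 1⌋ + 1, 2 * ⌊x 1⌋ - ⌊x 0⌋ + ⌊x 0 + x 1⌋ + 1) := by
    intro l r h hx
    obtain ⟨m, n, ⟨hs, h1, -⟩ | ⟨hs, h1, -⟩⟩ := h.triangle_cases <;>
      obtain ⟨a1, a2, a3⟩ := (h1 x).1 hx <;> rw [hs]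
    · have e1 : ⌊x 0⌋ = m := Int.floor_eq_iff.2 ⟨by linarith, by linarith⟩
      have e2 : ⌊x 1⌋ = n := Int.floor_eq_iff.2 ⟨by linarith, by linarith⟩
      have e3 : ⌊x 0 + x 1⌋ = m + n :=
        Int.floor_eq_iff.2 ⟨by push_cast; linarith, by push_cast; linarith⟩
      rw [e1, e2, e3, Prod.ext_iff]
      constructor <;> simp only <;> ring
    · have e1 : ⌊x 0⌋ = m := Int.floor_eq_iff.2 ⟨by linarith, by linarith⟩
      have e2 : ⌊x 1⌋ = n := Int.floor_eq_iff.2 ⟨by linarith, by linarith⟩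
      have e3 : ⌊x 0 + x 1⌋ = m + n + 1 :=
        Int.floor_eq_iff.2 ⟨by push_cast; linarith, by push_cast; linarith⟩
      rw [e1, e2, e3, Prod.ext_iff]
      constructor <;> simp only <;> ring
  rw [key h hx, key h' hx']

theorem notMem_range_of_mem_openSegment {p q : ℤ × ℤ} (h : IsLatticeEdge p q) {x : Plane}
    (hx : x ∈ openSegment ℝ (latticePt p) (latticePt q)) : x ∉ range latticePt := by
  rintro ⟨⟨c, d⟩, rfl⟩
  obtain ⟨θ, h0, h1, hx0, hx1⟩ := mem_openSegment_lattice_iff.1 hx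
  obtain ⟨a, b⟩ := p
  simp only [latticePt_apply_zero, latticePt_apply_one] at hx0 hx1
  rcases h.cases with rfl | rfl | rfl | rfl | rfl | rfl <;> push_cast at hx0 hx1
  · exact not_int_of_between (m := a) (n := c) (y := c) (by linarith) (by linarith) rfl
  · exact not_int_of_between (m := a - 1) (n := c) (y := c) (by push_cast; linarith)
      (by push_cast; linarith) rfl
  · exact not_int_of_between (m := b) (n := d) (y := d) (by linarith) (by linarith) rfl
  · exact not_int_of_between (m := b - 1) (n := d) (y := d) (by push_cast; linarith)
      (by push_cast; linarith) rfl
  · exact not_int_of_between (m := a) (n := c) (y := c) (by linarith) (by linarith) rfl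
  · exact not_int_of_between (m := a - 1) (n := c) (y := c) (by push_cast; linarith)
      (by push_cast; linarith) rfl

/-- Different lattice edges have disjoint interiors. -/
theorem edge_eq_of_mem_openSegment {p q p' q' : ℤ × ℤ} (h : IsLatticeEdge p q)
    (h' : IsLatticeEdge p' q') {x : Plane} (hx : x ∈ openSegment ℝ (latticePt p) (latticePt q))
    (hx' : x ∈ openSegment ℝ (latticePt p') (latticePt q')) : s(p, q) = s(p', q') := by
  -- Up to exchanging its endpoints, an edge has one of three directions, which is determined by
  -- the integral one among `x`, `y` and `x + y`; its position is then given by rounding down.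
  have key : ∀ {p q : ℤ × ℤ}, IsLatticeEdge p q →
      x ∈ openSegment ℝ (latticePt p) (latticePt q) → ∃ a b : ℤ,
      (s(p, q) = s((a, b), (a + 1, b)) ∧ a < x 0 ∧ x 0 < a + 1 ∧ x 1 = b) ∨
      (s(p, q) = s((a, b), (a, b + 1)) ∧ x 0 = a ∧ b < x 1 ∧ x 1 < b + 1) ∨
      (s(p, q) = s((a, b + 1), (a + 1, b)) ∧ a < x 0 ∧ x 0 < a + 1 ∧ x 0 + x 1 = a + b + 1) := by
    intro p q h hx
    obtain ⟨θ, h0, h1, hx0, hx1⟩ := mem_openSegment_lattice_iff.1 hx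
    obtain ⟨a, b⟩ := p
    rcases h.cases with rfl | rfl | rfl | rfl | rfl | rfl <;> push_cast at hx0 hx1
    · refine ⟨a, b, Or.inl ⟨rfl, ?_, ?_, ?_⟩⟩ <;> linarith
    · refine ⟨a - 1, b, Or.inl ⟨by simp, ?_, ?_, ?_⟩⟩ <;> push_cast <;> linarith
    · refine ⟨a, b, Or.inr (Or.inl ⟨rfl, ?_, ?_, ?_⟩)⟩ <;> linarith
    · refine ⟨a, b - 1, Or.inr (Or.inl ⟨by simp, ?_, ?_, ?_⟩)⟩ <;> push_cast <;> linarith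
    · refine ⟨a, b - 1, Or.inr (Or.inr ⟨by simp, ?_, ?_, ?_⟩)⟩ <;> push_cast <;> linarith
    · refine ⟨a - 1, b, Or.inr (Or.inr ⟨by simp, ?_, ?_, ?_⟩)⟩ <;> push_cast <;> linarith
  have eqI : ∀ {y : ℝ} {m n : ℤ}, (m : ℝ) < y → y < m + 1 → (n : ℝ) < y → y < n + 1 → m = n := by
    intro y m n a1 a2 a3 a4
    have h1 : (m : ℝ) < n + 1 := by linarith
    have h2 : (n : ℝ) < m + 1 := by linarith
    have h1 : m < n + 1 := by exact_mod_cast h1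
    have h2 : n < m + 1 := by exact_mod_cast h2
    omega
  obtain ⟨a, b, ⟨e, h1, h2, h3⟩ | ⟨e, h1, h2, h3⟩ | ⟨e, h1, h2, h3⟩⟩ := key h hx <;>
    obtain ⟨c, d, ⟨e', h1', h2', h3'⟩ | ⟨e', h1', h2', h3'⟩ | ⟨e', h1', h2', h3'⟩⟩ := key h' hx' <;>
    rw [e, e']
  · obtain rfl := eqI h1 h2 h1' h2'
    obtain rfl : b = d := Int.cast_injective (α := ℝ) (h3.symm.trans h3')
    rfl
  · exact (not_int_of_between h1 h2 h1').elim
  · exact (not_int_of_between (n := c + d + 1 - b) h1 h2 (by push_cast; linarith)).elim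
  · exact (not_int_of_between h1' h2' h1).elim
  · obtain rfl := eqI h2 h3 h2' h3'
    obtain rfl : a = c := Int.cast_injective (α := ℝ) (h1.symm.trans h1')
    rfl
  · exact (not_int_of_between h1' h2' h1).elim
  · exact (not_int_of_between (n := a + b + 1 - d) h1' h2' (by push_cast; linarith)).elim
  · exact (not_int_of_between h1 h2 h1').elim
  · obtain rfl := eqI h1 h2 h1' h2'
    obtain rfl : b = d := by
      have : (b : ℝ) = d := by linarith
      exact_mod_cast this
    rfl

/-! ### Points on the boundary of a triangle -/

/-- A point is the combination of the vertices of a triangle with its barycentric coordinates as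
coefficients. -/
theorem IsLatticeEdge.eq_combination {l r : ℤ × ℤ} (h : IsLatticeEdge l r) (x : Plane) :
    x 0 = sideOf r (apex l r) x * l.1 + sideOf (apex l r) l x * r.1
        + sideOf l r x * (apex l r).1 ∧
      x 1 = sideOf r (apex l r) x * l.2 + sideOf (apex l r) l x * r.2
        + sideOf l r x * (apex l r).2 := by
  obtain ⟨a, b⟩ := l
  rcases h.cases with rfl | rfl | rfl | rfl | rfl | rfl <;>
  · simp only [sideOf, apex]
    push_cast
    constructor <;> ring

theorem mem_openSegment_of_sideOf_eq_zero {l r : ℤ × ℤ} (h : IsLatticeEdge l r) {x : Plane}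
    (hx : x ∈ closedTriangle l r) (h0 : sideOf l r x = 0) (hn : x ∉ range latticePt) :
    x ∈ openSegment ℝ (latticePt l) (latticePt r) := by
  have hs := h.sideOf_add x
  obtain ⟨e0, e1⟩ := h.eq_combination x
  obtain ⟨-, h1, h2⟩ := hx
  rw [h0] at hs e0 e1
  have e : sideOf r (apex l r) x = 1 - sideOf (apex l r) l x := by linarith
  rw [e] at e0 e1 h1
  generalize sideOf (apex l r) l x = θ at *
  refine mem_openSegment_lattice_iff.2 ⟨θ, lt_of_le_of_ne h2 ?_, lt_of_le_of_ne (by linarith) ?_,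
    by rw [e0]; ring, by rw [e1]; ring⟩
  · rintro rfl
    exact hn ⟨l, Plane.ext_coord (by simp [e0]) (by simp [e1])⟩
  · rintro rfl
    exact hn ⟨r, Plane.ext_coord (by simp [e0]) (by simp [e1])⟩

/-- A lattice edge whose interior meets a closed triangle is one of its sides. -/
theorem edge_mem_of_mem_closedTriangle {l r p q : ℤ × ℤ} (h : IsLatticeEdge l r)
    (h' : IsLatticeEdge p q) {x : Plane} (hx : x ∈ closedTriangle l r)
    (hpq : x ∈ openSegment ℝ (latticePt p) (latticePt q)) :
    s(p, q) = s(l, r) ∨ s(p, q) = s(r, apex l r) ∨ s(p, q) = s(apex l r, l) := by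
  have hn := notMem_range_of_mem_openSegment h' hpq
  by_cases h0 : sideOf l r x = 0
  · exact Or.inl (edge_eq_of_mem_openSegment h' h hpq
      (mem_openSegment_of_sideOf_eq_zero h hx h0 hn))
  by_cases h1 : sideOf r (apex l r) x = 0
  · refine Or.inr (Or.inl (edge_eq_of_mem_openSegment h' h.right_apex hpq
      (mem_openSegment_of_sideOf_eq_zero h.right_apex ?_ h1 hn)))
    rwa [closedTriangle_rotate]
  by_cases h2 : sideOf (apex l r) l x = 0
  · refine Or.inr (Or.inr (edge_eq_of_mem_openSegment h' h.apex_left hpq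
      (mem_openSegment_of_sideOf_eq_zero h.apex_left ?_ h2 hn)))
    rw [← closedTriangle_rotate, apex_apex_left]
    exact hx
  · refine absurd (h'.openSegment_subset_latticeGrid hpq)
      (notMem_latticeGrid_of_mem_openTriangle h ?_)
    exact ⟨lt_of_le_of_ne hx.1 (Ne.symm h0), lt_of_le_of_ne hx.2.1 (Ne.symm h1),
      lt_of_le_of_ne hx.2.2 (Ne.symm h2)⟩

/-- A lattice point of a closed triangle is one of its vertices. -/
theorem vertex_of_mem_closedTriangle {l r p : ℤ × ℤ} (h : IsLatticeEdge l r)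
    (hp : latticePt p ∈ closedTriangle l r) : p = l ∨ p = r ∨ p = apex l r := by
  obtain ⟨a, b⟩ := l
  obtain ⟨c, d⟩ := p
  obtain ⟨h1, h2, h3⟩ := hp
  rcases h.cases with rfl | rfl | rfl | rfl | rfl | rfl <;>
  · simp only [sideOf, apex, latticePt_apply_zero, latticePt_apply_one] at h1 h2 h3
    norm_cast at h1 h2 h3
    simp only [apex, Prod.ext_iff]
    ring_nf at h1 h2 h3
    omega

theorem sideOf_self_left (l r : ℤ × ℤ) : sideOf l r (latticePt l) = 0 := by
  simp [sideOf]

theorem sideOf_self_right (l r : ℤ × ℤ) : sideOf l r (latticePt r) = 0 := by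
  simp [sideOf]
  ring

/-- The barycentric coordinates of a point in the interior of a side. -/
theorem sideOf_of_mem_openSegment {l r : ℤ × ℤ} (h : IsLatticeEdge l r) {x : Plane}
    (hx : x ∈ openSegment ℝ (latticePt l) (latticePt r)) :
    sideOf l r x = 0 ∧ 0 < sideOf r (apex l r) x ∧ 0 < sideOf (apex l r) l x := by
  obtain ⟨θ, h0, h1, hx0, hx1⟩ := mem_openSegment_lattice_iff.1 hx
  obtain ⟨a, b⟩ := l
  rcases h.cases with rfl | rfl | rfl | rfl | rfl | rfl <;>
  · simp only [sideOf, apex, hx0, hx1]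
    push_cast
    refine ⟨?_, ?_, ?_⟩ <;> linarith

theorem sideOf_apex {l r : ℤ × ℤ} (h : IsLatticeEdge l r) :
    sideOf l r (latticePt (apex l r)) = 1 := by
  have := h.sideOf_add (latticePt (apex l r))
  rwa [sideOf_self_right, sideOf_self_left, add_zero, add_zero] at this

namespace LatticeArc

variable {A B : ℤ × ℤ}

/-! ### The sequence of triangles visited by an arc -/

theorem mem_openTriangle_of_no_crossing (γ : LatticeArc A B) {S : Set ℝ} (hS : IsPreconnected S)
    (h01 : S ⊆ Ioo 0 1) (hno : ∀ i < γ.numCrossings, γ.time i ∉ S) {l r : ℤ × ℤ}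
    (h : IsLatticeEdge l r) {t₀ : ℝ} (ht₀ : t₀ ∈ S) (hT : γ.curve t₀ ∈ openTriangle l r) :
    ∀ t ∈ S, γ.curve t ∈ openTriangle l r := by
  have hc : ContinuousOn γ.curve S :=
    γ.continuousOn_curve.mono (h01.trans Ioo_subset_Icc_self)
  have := (hS.image _ hc).subset_openTriangle ?_ h ⟨_, mem_image_of_mem _ ht₀, hT⟩
  · exact fun t ht => this (mem_image_of_mem _ ht)
  · rintro _ ⟨t, ht, rfl⟩ hg
    obtain ⟨i, hi, rfl⟩ := (γ.crossing_times t (h01 ht)).1 hg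
    exact hno i hi ht

theorem continuousAt_curve (γ : LatticeArc A B) {t : ℝ} (ht : t ∈ Ioo (0 : ℝ) 1) :
    ContinuousAt γ.curve t :=
  γ.continuousOn_curve.continuousAt (Icc_mem_nhds ht.1 ht.2)

theorem eventually_sideOf_pos (γ : LatticeArc A B) {i : ℕ} (hi : i < γ.numCrossings)
    {p q : ℤ × ℤ} (h : 0 < sideOf p q (γ.curve (γ.time i))) :
    ∀ᶠ t in 𝓝 (γ.time i), 0 < sideOf p q (γ.curve t) :=
  ((continuous_sideOf p q).continuousAt.comp
    (γ.continuousAt_curve (γ.time_mem i hi))).eventually (lt_mem_nhds h)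

theorem eventually_after (γ : LatticeArc A B) {i : ℕ} (hi : i < γ.numCrossings) :
    ∀ᶠ t in 𝓝[>] (γ.time i), γ.curve t ∈ openTriangle (γ.left i) (γ.right i) := by
  obtain ⟨-, h1, h2⟩ := sideOf_of_mem_openSegment (γ.isLatticeEdge i hi) (γ.curve_time_mem i hi)
  filter_upwards [γ.side_after i hi, nhdsWithin_le_nhds (γ.eventually_sideOf_pos hi h1),
    nhdsWithin_le_nhds (γ.eventually_sideOf_pos hi h2)] with t a b c
  exact ⟨a, b, c⟩

theorem eventually_before (γ : LatticeArc A B) {i : ℕ} (hi : i < γ.numCrossings) :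
    ∀ᶠ t in 𝓝[<] (γ.time i), γ.curve t ∈ openTriangle (γ.right i) (γ.left i) := by
  obtain ⟨-, h1, h2⟩ := sideOf_of_mem_openSegment (γ.isLatticeEdge i hi).symm
    ((openSegment_symm ℝ (latticePt (γ.left i)) (latticePt (γ.right i))) ▸ γ.curve_time_mem i hi)
  filter_upwards [γ.side_before i hi, nhdsWithin_le_nhds (γ.eventually_sideOf_pos hi h1),
    nhdsWithin_le_nhds (γ.eventually_sideOf_pos hi h2)] with t a b c
  exact ⟨by rw [sideOf_swap]; linarith, b, c⟩

/-- The arc stays in the triangle beyond the `i`-th segment as long as it crosses no segment. -/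
theorem mem_openTriangle_after (γ : LatticeArc A B) {i : ℕ} (hi : i < γ.numCrossings) {v : ℝ}
    (hv : v ≤ 1) (hno : ∀ j < γ.numCrossings, γ.time j ∉ Ioo (γ.time i) v) :
    ∀ t ∈ Ioo (γ.time i) v, γ.curve t ∈ openTriangle (γ.left i) (γ.right i) := by
  intro t ht
  obtain ⟨t₀, h, h'⟩ := ((γ.eventually_after hi).and
    (Ioo_mem_nhdsGT (ht.1.trans ht.2))).exists
  exact γ.mem_openTriangle_of_no_crossing isPreconnected_Ioo
    (Ioo_subset_Ioo (γ.time_mem i hi).1.le hv) hno (γ.isLatticeEdge i hi) h' h t ht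

/-- The arc stays in the triangle behind the `i`-th segment since it last crossed a segment. -/
theorem mem_openTriangle_before (γ : LatticeArc A B) {i : ℕ} (hi : i < γ.numCrossings) {u : ℝ}
    (hu : 0 ≤ u) (hno : ∀ j < γ.numCrossings, γ.time j ∉ Ioo u (γ.time i)) :
    ∀ t ∈ Ioo u (γ.time i), γ.curve t ∈ openTriangle (γ.right i) (γ.left i) := by
  intro t ht
  obtain ⟨t₀, h, h'⟩ := ((γ.eventually_before hi).and
    (Ioo_mem_nhdsLT (ht.1.trans ht.2))).exists
  exact γ.mem_openTriangle_of_no_crossing isPreconnected_Ioo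
    (Ioo_subset_Ioo hu (γ.time_mem i hi).2.le) hno (γ.isLatticeEdge i hi).symm h' h t ht

/-- The end points of a piece of the arc in an open triangle lie in the closed triangle. -/
theorem mem_closedTriangle_of_Ioo (γ : LatticeArc A B) {u v : ℝ} (hu : 0 ≤ u) (huv : u < v)
    (hv : v ≤ 1) {l r : ℤ × ℤ} (h : ∀ t ∈ Ioo u v, γ.curve t ∈ openTriangle l r) :
    γ.curve u ∈ closedTriangle l r ∧ γ.curve v ∈ closedTriangle l r := by
  have key : ∀ t ∈ Icc u v, γ.curve t ∈ closedTriangle l r := by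
    intro t ht
    rw [← closure_Ioo huv.ne] at ht
    have hc : ContinuousOn γ.curve (closure (Ioo u v)) := by
      rw [closure_Ioo huv.ne]
      exact γ.continuousOn_curve.mono (Icc_subset_Icc hu hv)
    have := hc.image_closure (mem_image_of_mem _ ht)
    refine closure_minimal ?_ (isClosed_closedTriangle l r) this
    rintro _ ⟨t, ht, rfl⟩
    exact openTriangle_subset_closedTriangle _ _ (h t ht)
  exact ⟨key u ⟨le_rfl, huv.le⟩, key v ⟨huv.le, le_rfl⟩⟩

theorem time_le_time (γ : LatticeArc A B) {i j : ℕ} (hij : i ≤ j) (hj : j < γ.numCrossings) :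
    γ.time i ≤ γ.time j := by
  rcases hij.eq_or_lt with rfl | h
  · exact le_rfl
  · exact (γ.time_lt_time i j h hj).le

theorem time_notMem_Ioo_succ (γ : LatticeArc A B) {i : ℕ} (hi : i + 1 < γ.numCrossings) :
    ∀ j < γ.numCrossings, γ.time j ∉ Ioo (γ.time i) (γ.time (i + 1)) := by
  rintro j hj ⟨h1, h2⟩
  rcases Nat.lt_or_ge i j with h | h
  · exact absurd (γ.time_le_time (Nat.succ_le_of_lt h) hj) (not_le.2 h2)
  · exact absurd (γ.time_le_time h (by omega)) (not_le.2 h1)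

/-- Two consecutive segments crossed by an arc bound a common triangle, and share an endpoint on
one side of the arc. -/
theorem step (γ : LatticeArc A B) {i : ℕ} (hi : i + 1 < γ.numCrossings) :
    (γ.left (i + 1) = γ.left i ∧ γ.right (i + 1) = apex (γ.left i) (γ.right i)) ∨
      (γ.left (i + 1) = apex (γ.left i) (γ.right i) ∧ γ.right (i + 1) = γ.right i) := by
  have hi' : i < γ.numCrossings := by omega
  have hlt := γ.time_lt_time i (i + 1) (by omega) hi
  have hm := γ.time_mem i hi'
  have hm' := γ.time_mem (i + 1) hi
  have hin := γ.mem_openTriangle_after hi' hm'.2.le (γ.time_notMem_Ioo_succ hi)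
  have hcl := (γ.mem_closedTriangle_of_Ioo hm.1.le hlt hm'.2.le hin).2
  obtain ⟨t₀, h, h'⟩ := ((γ.side_before (i + 1) hi).and (Ioo_mem_nhdsLT hlt)).exists
  obtain ⟨s1, s2, s3⟩ := hin t₀ h'
  -- A common endpoint on the wrong side contradicts the direction of the crossing.
  rcases edge_mem_of_mem_closedTriangle (γ.isLatticeEdge i hi') (γ.isLatticeEdge (i + 1) hi) hcl
    (γ.curve_time_mem (i + 1) hi) with e | e | e
  · exact absurd e.symm (γ.no_bigon i hi)
  · rcases Sym2.eq_iff.1 e with ⟨e1, e2⟩ | ⟨e1, e2⟩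
    · rw [e1, e2] at h
      linarith
    · exact Or.inr ⟨e1, e2⟩
  · rcases Sym2.eq_iff.1 e with ⟨e1, e2⟩ | ⟨e1, e2⟩
    · rw [e1, e2] at h
      linarith
    · exact Or.inl ⟨e1, e2⟩

theorem start_eq_apex (γ : LatticeArc A B) (h : 0 < γ.numCrossings) :
    A = apex (γ.right 0) (γ.left 0) := by
  have hm := γ.time_mem 0 h
  have hin := γ.mem_openTriangle_before h le_rfl (u := 0) (fun j hj hmem =>
    absurd (γ.time_le_time (Nat.zero_le j) hj) (not_le.2 hmem.2))
  have hcl := (γ.mem_closedTriangle_of_Ioo le_rfl hm.1 hm.2.le hin).1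
  rw [γ.curve_zero] at hcl
  have := γ.first_crossing h
  rw [Sym2.mem_iff] at this
  have := vertex_of_mem_closedTriangle (γ.isLatticeEdge 0 h).symm hcl
  tauto

theorem end_eq_apex (γ : LatticeArc A B) {i : ℕ} (h : i + 1 = γ.numCrossings) :
    B = apex (γ.left i) (γ.right i) := by
  have hi : i < γ.numCrossings := by omega
  have hm := γ.time_mem i hi
  have hin := γ.mem_openTriangle_after hi le_rfl (fun j hj hmem =>
    absurd (γ.time_le_time (show j ≤ i by omega) hi) (not_le.2 hmem.1))
  have hcl := (γ.mem_closedTriangle_of_Ioo hm.1.le hm.2 le_rfl hin).2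
  rw [γ.curve_one] at hcl
  have := γ.last_crossing i h
  rw [Sym2.mem_iff] at this
  have := vertex_of_mem_closedTriangle (γ.isLatticeEdge i hi) hcl
  tauto

/-- The label of the triangle that the arc visits between its crossings `i - 1` and `i`; it is
meaningful for `i ≤ numCrossings` if the arc has a crossing at all. -/
def label (γ : LatticeArc A B) (i : ℕ) : ℤ × ℤ :=
  if i < γ.numCrossings then triSum (γ.right i) (γ.left i)
  else triSum (γ.left (γ.numCrossings - 1)) (γ.right (γ.numCrossings - 1))

theorem label_of_lt (γ : LatticeArc A B) {i : ℕ} (hi : i < γ.numCrossings) :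
    γ.label i = triSum (γ.right i) (γ.left i) :=
  if_pos hi

theorem label_succ (γ : LatticeArc A B) {i : ℕ} (hi : i < γ.numCrossings) :
    γ.label (i + 1) = triSum (γ.left i) (γ.right i) := by
  rcases Nat.lt_or_ge (i + 1) γ.numCrossings with h | h
  · rw [label_of_lt _ h]
    rcases γ.step h with ⟨e1, e2⟩ | ⟨e1, e2⟩ <;> rw [e1, e2] <;> ext <;>
      simp only [triSum, apex, Prod.fst_add, Prod.snd_add] <;> ring
  · have : γ.numCrossings - 1 = i := by omega
    rw [label, if_neg (by omega), this]

/-! ### Self-intersections -/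

theorem exists_crossings_before (γ : LatticeArc A B) {s : ℝ}
    (hs : ∀ i < γ.numCrossings, γ.time i ≠ s) : ∃ i ≤ γ.numCrossings,
      (∀ a < i, γ.time a < s) ∧ ∀ a, i ≤ a → a < γ.numCrossings → s < γ.time a := by
  classical
  have hex : ∃ i, i = γ.numCrossings ∨ s < γ.time i := ⟨_, Or.inl rfl⟩
  have hle : Nat.find hex ≤ γ.numCrossings := Nat.find_min' hex (Or.inl rfl)
  refine ⟨Nat.find hex, hle, fun a ha => ?_, fun a ha han => ?_⟩
  · have := Nat.find_min hex ha
    push Not at this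
    exact lt_of_le_of_ne this.2 (hs a (by omega))
  · rcases Nat.find_spec hex with h | h
    · omega
    · exact h.trans_le (γ.time_le_time ha han)

theorem triSum_eq_label (γ : LatticeArc A B) (hn : 0 < γ.numCrossings) {s : ℝ}
    (hs : s ∈ Ioo (0 : ℝ) 1) {i : ℕ} (hi : i ≤ γ.numCrossings) (hbefore : ∀ a < i, γ.time a < s)
    (hafter : ∀ a, i ≤ a → a < γ.numCrossings → s < γ.time a) {l r : ℤ × ℤ}
    (h : IsLatticeEdge l r) (hx : γ.curve s ∈ openTriangle l r) : triSum l r = γ.label i := by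
  rcases hi.eq_or_lt with rfl | hi
  · obtain ⟨m, hm⟩ : ∃ m, m + 1 = γ.numCrossings := ⟨γ.numCrossings - 1, by omega⟩
    have hml : m < γ.numCrossings := by omega
    rw [← hm, label_succ _ hml]
    refine triSum_eq_of_mem h (γ.isLatticeEdge m hml) hx ?_
    refine γ.mem_openTriangle_after hml le_rfl (fun j hj hmem => ?_) s ⟨hbefore m hml, hs.2⟩
    exact absurd (γ.time_le_time (show j ≤ m by omega) hml) (not_le.2 hmem.1)
  · rw [label_of_lt _ hi]
    refine triSum_eq_of_mem h (γ.isLatticeEdge i hi).symm hx ?_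
    obtain ⟨t₀, h, h'⟩ := ((γ.eventually_before hi).and
      (Ioo_mem_nhdsLT (hafter i le_rfl hi))).exists
    refine γ.mem_openTriangle_of_no_crossing (S := Ico s (γ.time i)) isPreconnected_Ico
      (fun t ht => ⟨hs.1.trans_le ht.1, ht.2.trans (γ.time_mem i hi).2⟩) (fun j hj hmem => ?_)
      (γ.isLatticeEdge i hi).symm ⟨h'.1.le, h'.2⟩ h s ⟨le_rfl, hafter i le_rfl hi⟩
    rcases Nat.lt_or_ge j i with hji | hji
    · exact absurd (hbefore j hji) (not_lt.2 hmem.1)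
    · exact absurd (γ.time_le_time hji hj) (not_le.2 hmem.2)

theorem homotopic_refl_of_mem_openTriangle {l r : ℤ × ℤ} (h : IsLatticeEdge l r)
    {C : PuncturedPlane} (loop : Path C C) (hT : ∀ u, (loop u : Plane) ∈ openTriangle l r) :
    loop.Homotopic (Path.refl C) := by
  have hC : (C : Plane) ∈ openTriangle l r := by
    have := hT 0
    rwa [loop.source] at this
  have : ContractibleSpace (openTriangle l r) :=
    (convex_openTriangle l r).contractibleSpace ⟨_, hC⟩
  let f : C(openTriangle l r, PuncturedPlane) :=
    ⟨fun x => ⟨x, fun hx => by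
      obtain ⟨p, hp⟩ := hx
      exact notMem_latticeGrid_of_mem_openTriangle h x.2 (hp ▸ latticePt_mem_latticeGrid p)⟩,
      by fun_prop⟩
  let loop' : Path (⟨C, hC⟩ : openTriangle l r) ⟨C, hC⟩ :=
    { toFun := fun u => ⟨loop u, hT u⟩
      continuous_toFun := by fun_prop
      source' := by simp
      target' := by simp }
  have := (SimplyConnectedSpace.paths_homotopic loop' (Path.refl _)).map f
  exact this

/-- An arc with a non-contractible self-intersection visits some triangle twice. -/
theorem exists_label_eq (γ : LatticeArc A B) (hγ : γ.HasNoncontractibleSelfIntersection) :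
    ∃ i j, i < j ∧ j ≤ γ.numCrossings ∧ γ.label i = γ.label j := by
  obtain ⟨s, t, hs, hst, ht, C, loop, hloop, hnc⟩ := hγ
  have hsI : s ∈ Ioo (0 : ℝ) 1 := ⟨hs, hst.trans ht⟩
  have htI : t ∈ Ioo (0 : ℝ) 1 := ⟨hs.trans hst, ht⟩
  have hsteq : γ.curve s = γ.curve t := by
    have h0 := hloop 0
    have h1 := hloop 1
    simp only [Path.source, Path.target, Set.Icc.coe_zero, Set.Icc.coe_one] at h0 h1
    rw [zero_mul, add_zero] at h0
    rw [one_mul, add_sub_cancel] at h1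
    rw [← h0, ← h1]
  by_cases hg : γ.curve s ∈ latticeGrid
  · obtain ⟨i, hi, rfl⟩ := (γ.crossing_times s hsI).1 hg
    obtain ⟨j, hj, rfl⟩ := (γ.crossing_times t htI).1 (hsteq ▸ hg)
    have hij : i < j := by
      by_contra hc
      exact absurd (γ.time_le_time (not_lt.1 hc) hi) (not_le.2 hst)
    have e := edge_eq_of_mem_openSegment (γ.isLatticeEdge i hi) (γ.isLatticeEdge j hj)
      (γ.curve_time_mem i hi) (hsteq ▸ γ.curve_time_mem j hj)
    rcases Sym2.eq_iff.1 e with ⟨e1, e2⟩ | ⟨e1, e2⟩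
    · exact ⟨i, j, hij, hj.le, by rw [label_of_lt _ hi, label_of_lt _ hj, e1, e2]⟩
    · -- The segment is crossed back, but not immediately.
      have hne : i + 1 ≠ j := by
        rintro rfl
        exact γ.no_bigon i hj e
      exact ⟨i + 1, j, by omega, hj.le, by rw [label_succ _ hi, label_of_lt _ hj, e1, e2]⟩
  · have hs' : ∀ i < γ.numCrossings, γ.time i ≠ s := fun i hi h =>
      hg ((γ.crossing_times s hsI).2 ⟨i, hi, h⟩)
    have ht' : ∀ i < γ.numCrossings, γ.time i ≠ t := fun i hi h =>
      hg (hsteq ▸ (γ.crossing_times t htI).2 ⟨i, hi, h⟩)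
    obtain ⟨i, hi, hi1, hi2⟩ := γ.exists_crossings_before hs'
    obtain ⟨j, hj, hj1, hj2⟩ := γ.exists_crossings_before ht'
    obtain ⟨l, r, h, hx⟩ := exists_mem_openTriangle hg
    rcases lt_trichotomy i j with hij | rfl | hij
    · refine ⟨i, j, hij, hj, ?_⟩
      rw [← γ.triSum_eq_label (by omega) hsI hi hi1 hi2 h hx,
        γ.triSum_eq_label (by omega) htI hj hj1 hj2 h (hsteq ▸ hx)]
    · -- No crossing takes place between the times `s` and `t`, so the loop lies in a triangle.
      refine absurd (homotopic_refl_of_mem_openTriangle h loop fun u => ?_) hnc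
      rw [hloop u]
      refine γ.mem_openTriangle_of_no_crossing (S := Icc s t) isPreconnected_Icc
        (fun x hx => ⟨hs.trans_le hx.1, hx.2.trans_lt ht⟩) (fun a ha hmem => ?_) h
        ⟨le_rfl, hst.le⟩ hx _ ⟨?_, ?_⟩
      · rcases Nat.lt_or_ge a i with hai | hai
        · exact absurd (hi1 a hai) (not_lt.2 hmem.1)
        · exact absurd (hj2 a hai ha) (not_lt.2 hmem.2)
      · nlinarith [u.2.1]
      · nlinarith [u.2.2]
    · linarith [hi1 j hij, hj2 j le_rfl (by omega)]

end LatticeArc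

/-! ### Arcs with prescribed crossings -/

/-- The curve that runs through `Q 0, …, Q N` along line segments, and reaches `Q i` at time `i`. -/
def polygonalCurve (Q : ℕ → Plane) (N : ℕ) (u : ℝ) : Plane :=
  Q 0 + ∑ i ∈ Finset.range N, max 0 (min 1 (u - i)) • (Q (i + 1) - Q i)

theorem continuous_polygonalCurve (Q : ℕ → Plane) (N : ℕ) : Continuous (polygonalCurve Q N) := by
  unfold polygonalCurve
  fun_prop

theorem polygonalCurve_eq (Q : ℕ → Plane) {N m : ℕ} (hm : m < N) {u : ℝ} (h1 : m ≤ u)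
    (h2 : u ≤ m + 1) : polygonalCurve Q N u = Q m + (u - m) • (Q (m + 1) - Q m) := by
  have hsub : Finset.range (m + 1) ⊆ Finset.range N := by
    simpa using hm
  rw [polygonalCurve, ← Finset.sum_subset hsub, Finset.sum_range_succ, ← add_assoc]
  · congr 1
    · rw [Finset.sum_congr rfl (g := fun i => Q (i + 1) - Q i), Finset.sum_range_sub]
      · abel
      · intro i hi
        have : ((i + 1 : ℕ) : ℝ) ≤ m := by exact_mod_cast Finset.mem_range.1 hi
        push_cast at this
        rw [min_eq_left (by linarith), max_eq_right zero_le_one, one_smul]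
    · rw [min_eq_right (by linarith), max_eq_right (by linarith)]
  · intro i _ hi
    have : ((m + 1 : ℕ) : ℝ) ≤ i := by exact_mod_cast not_lt.1 (mt Finset.mem_range.2 hi)
    push_cast at this
    rw [max_eq_left ((min_le_right _ _).trans (by linarith)), zero_smul]

theorem polygonalCurve_natCast (Q : ℕ → Plane) {N m : ℕ} (hm : m ≤ N) :
    polygonalCurve Q N m = Q m := by
  rcases hm.eq_or_lt with rfl | hm
  · rcases m with _ | m
    · simp [polygonalCurve]
    · rw [polygonalCurve_eq Q (Nat.lt_succ_self m) (by push_cast; linarith)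
        (by push_cast; linarith)]
      push_cast
      rw [add_sub_cancel_left, one_smul, add_sub_cancel]
  · rw [polygonalCurve_eq Q hm le_rfl (by linarith)]
    simp

theorem polygonalCurve_mem_openSegment (Q : ℕ → Plane) {N m : ℕ} (hm : m < N) {u : ℝ}
    (h1 : m < u) (h2 : u < m + 1) : polygonalCurve Q N u ∈ openSegment ℝ (Q m) (Q (m + 1)) := by
  rw [polygonalCurve_eq Q hm h1.le h2.le]
  refine ⟨1 - (u - m), u - m, by linarith, by linarith, by ring, ?_⟩
  module

theorem openSegment_apex_subset {l r : ℤ × ℤ} (h : IsLatticeEdge l r) {x : Plane}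
    (hx : x ∈ openSegment ℝ (latticePt l) (latticePt r)) :
    openSegment ℝ (latticePt (apex l r)) x ⊆ openTriangle l r := by
  obtain ⟨h1, h2, h3⟩ := sideOf_of_mem_openSegment h hx
  have ha := sideOf_apex h
  refine openSegment_subset_openTriangle ⟨?_, ?_, ?_⟩ ⟨h1.ge, h2.le, h3.le⟩ (Or.inl ?_)
    (Or.inr h2) (Or.inr h3)
  · rw [ha]; exact zero_le_one
  · rw [sideOf_self_right]
  · rw [sideOf_self_left]
  · rw [ha]; exact zero_lt_one

/-- The segment between the crossings of two sides of a triangle runs inside the triangle. -/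
theorem openSegment_step_subset {l r l' r' : ℤ × ℤ} (h : IsLatticeEdge l r) {x y : Plane}
    (hs : (l' = l ∧ r' = apex l r) ∨ (l' = apex l r ∧ r' = r))
    (hx : x ∈ openSegment ℝ (latticePt l) (latticePt r))
    (hy : y ∈ openSegment ℝ (latticePt l') (latticePt r')) :
    openSegment ℝ x y ⊆ openTriangle l r := by
  obtain ⟨h1, h2, h3⟩ := sideOf_of_mem_openSegment h hx
  rw [openSegment_symm] at hy
  rcases hs with ⟨rfl, rfl⟩ | ⟨rfl, rfl⟩
  · obtain ⟨k1, k2, k3⟩ := sideOf_of_mem_openSegment h.apex_left hy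
    rw [apex_apex_left] at k2 k3
    exact openSegment_subset_openTriangle ⟨h1.ge, h2.le, h3.le⟩ ⟨k2.le, k3.le, k1.ge⟩
      (Or.inr k2) (Or.inl h2) (Or.inl h3)
  · obtain ⟨k1, k2, k3⟩ := sideOf_of_mem_openSegment h.right_apex hy
    rw [apex_right_apex] at k2 k3
    exact openSegment_subset_openTriangle ⟨h1.ge, h2.le, h3.le⟩ ⟨k3.le, k1.ge, k2.le⟩
      (Or.inr k3) (Or.inl h2) (Or.inl h3)

theorem openTriangle_step {l r l' r' : ℤ × ℤ}
    (hs : (l' = l ∧ r' = apex l r) ∨ (l' = apex l r ∧ r' = r)) :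
    openTriangle r' l' = openTriangle l r := by
  rcases hs with ⟨rfl, rfl⟩ | ⟨rfl, rfl⟩
  · rw [← openTriangle_rotate, apex_apex_left]
  · rw [openTriangle_rotate]

theorem step_edge_ne {l r l' r' : ℤ × ℤ} (h : IsLatticeEdge l r)
    (hs : (l' = l ∧ r' = apex l r) ∨ (l' = apex l r ∧ r' = r)) : s(l, r) ≠ s(l', r') := by
  intro e
  apply h.apex_notMem
  rw [e]
  rcases hs with ⟨rfl, rfl⟩ | ⟨rfl, rfl⟩ <;> simp

/-- An arc can be drawn through any sequence of points in the interiors of lattice segments, if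
consecutive segments, and the endpoints of the arc, fit together in the triangulation. -/
theorem exists_latticeArc {A B : ℤ × ℤ} {n : ℕ} (hn : 0 < n) {left right : ℕ → ℤ × ℤ}
    (hedge : ∀ i < n, IsLatticeEdge (left i) (right i))
    (hstep : ∀ i, i + 1 < n →
      (left (i + 1) = left i ∧ right (i + 1) = apex (left i) (right i)) ∨
        (left (i + 1) = apex (left i) (right i) ∧ right (i + 1) = right i))
    (hA : A = apex (right 0) (left 0))
    (hB : ∀ i, i + 1 = n → B = apex (left i) (right i)) (P : ℕ → Plane)
    (hP : ∀ i < n, P i ∈ openSegment ℝ (latticePt (left i)) (latticePt (right i))) :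
    ∃ δ : LatticeArc A B, δ.numCrossings = n ∧ δ.left = left ∧ δ.right = right ∧
      ∀ i < n, δ.curve (δ.time i) = P i := by
  -- The vertices of the polygonal curve: `A`, the crossing points, `B`.
  set Q : ℕ → Plane := fun m =>
    if m = 0 then latticePt A else if m ≤ n then P (m - 1) else latticePt B with hQ
  have Q0 : Q 0 = latticePt A := if_pos rfl
  have Qs : ∀ i < n, Q (i + 1) = P i := fun i hi => by
    simp only [hQ]
    rw [if_neg (by omega), if_pos (by omega), Nat.add_sub_cancel]
  have Qn : Q (n + 1) = latticePt B := by
    simp only [hQ]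
    rw [if_neg (by omega), if_neg (by omega)]
  have hP' : ∀ i < n, P i ∈ openSegment ℝ (latticePt (right i)) (latticePt (left i)) :=
    fun i hi => by
      rw [openSegment_symm]
      exact hP i hi
  have hafter : ∀ i < n,
      openSegment ℝ (Q (i + 1)) (Q (i + 2)) ⊆ openTriangle (left i) (right i) := by
    intro i hi
    rw [Qs i hi]
    rcases Nat.lt_or_ge (i + 1) n with h | h
    · rw [Qs (i + 1) h]
      exact openSegment_step_subset (hedge i hi) (hstep i h) (hP i hi) (hP (i + 1) h)
    · obtain rfl : n = i + 1 := by omega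
      rw [Qn, openSegment_symm, hB i rfl]
      exact openSegment_apex_subset (hedge i hi) (hP i hi)
  have hbefore : ∀ i < n, openSegment ℝ (Q i) (Q (i + 1)) ⊆ openTriangle (right i) (left i) := by
    intro i hi
    rcases i with _ | i
    · rw [Q0, Qs 0 hi, hA]
      exact openSegment_apex_subset (hedge 0 hi).symm (hP' 0 hi)
    · rw [openTriangle_step (hstep i hi)]
      exact hafter i (by omega)
  have hpos : (0 : ℝ) < n + 1 := by positivity
  set curve : ℝ → Plane := fun t => polygonalCurve Q (n + 1) ((n + 1) * t) with hcurve
  set time : ℕ → ℝ := fun i => (i + 1) / (n + 1) with htime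
  have hct : ∀ i < n, curve (time i) = P i := by
    intro i hi
    have : ((n : ℝ) + 1) * time i = ((i + 1 : ℕ) : ℝ) := by
      simp only [htime]
      push_cast
      field_simp
    simp only [hcurve]
    rw [this, polygonalCurve_natCast Q (by omega), Qs i hi]
  have cafter : ∀ i < n, ∀ t, time i < t → t < time (i + 1) →
      curve t ∈ openTriangle (left i) (right i) := by
    intro i hi t h1 h2
    simp only [htime] at h1 h2
    rw [div_lt_iff₀ hpos] at h1
    rw [lt_div_iff₀ hpos] at h2
    push_cast at h2
    exact hafter i hi (polygonalCurve_mem_openSegment Q (by omega)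
      (by push_cast; linarith) (by push_cast; linarith))
  have cbefore : ∀ i < n, ∀ t, (i : ℝ) / (n + 1) < t → t < time i →
      curve t ∈ openTriangle (right i) (left i) := by
    intro i hi t h1 h2
    simp only [htime] at h2
    rw [div_lt_iff₀ hpos] at h1
    rw [lt_div_iff₀ hpos] at h2
    exact hbefore i hi (polygonalCurve_mem_openSegment Q (by omega)
      (by linarith) (by linarith))
  have tm : ∀ i < n, time i ∈ Ioo (0 : ℝ) 1 := by
    intro i hi
    have : ((i : ℝ)) < n := by exact_mod_cast hi
    exact ⟨by positivity, (div_lt_one hpos).2 (by linarith)⟩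
  have tlt : ∀ i j, i < j → time i < time j := by
    intro i j hij
    have : ((i : ℝ)) < j := by exact_mod_cast hij
    exact div_lt_div_of_pos_right (by linarith) hpos
  have locate : ∀ t ∈ Ioo (0 : ℝ) 1, (∃ i < n, time i = t) ∨
      ∃ l r, IsLatticeEdge l r ∧ curve t ∈ openTriangle l r := by
    rintro t ⟨h0, h1⟩
    have hu0 : 0 < (n + 1) * t := by positivity
    have hf := Nat.floor_le hu0.le
    have hf' := Nat.lt_floor_add_one ((n + 1) * t)
    have hmn : ⌊(n + 1) * t⌋₊ < n + 1 := by
      rw [Nat.floor_lt hu0.le]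
      push_cast
      nlinarith
    generalize ⌊(n + 1) * t⌋₊ = m at hf hf' hmn
    rcases hf.eq_or_lt with he | hlt
    · left
      rcases m with _ | m
      · simp at he
        rcases he with he | he <;> linarith
      · refine ⟨m, by omega, ?_⟩
        simp only [htime]
        push_cast at he
        rw [he]
        field_simp
    · right
      rcases Nat.lt_or_ge m n with h | h
      · refine ⟨_, _, (hedge m h).symm, cbefore m h t ?_ ?_⟩
        · rw [div_lt_iff₀ hpos]; linarith
        · rw [lt_div_iff₀ hpos]; linarith
      · obtain ⟨k, rfl⟩ : ∃ k, m = k + 1 := ⟨m - 1, by omega⟩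
        have hk : k < n := by omega
        push_cast at hlt hf'
        refine ⟨_, _, hedge k hk, cafter k hk t ?_ ?_⟩
        · simp only [htime]
          rw [div_lt_iff₀ hpos]; linarith
        · simp only [htime]
          rw [lt_div_iff₀ hpos]; push_cast; linarith
  refine ⟨{
    curve := curve
    continuousOn_curve := by
      have := continuous_polygonalCurve Q (n + 1)
      exact (this.comp (continuous_const.mul continuous_id)).continuousOn
    curve_zero := by
      simp only [hcurve, mul_zero]
      exact_mod_cast (polygonalCurve_natCast Q (Nat.zero_le _)).trans Q0
    curve_one := by
      simp only [hcurve, mul_one]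
      exact_mod_cast (polygonalCurve_natCast Q le_rfl).trans Qn
    curve_avoids := by
      rintro t ht ⟨p, hp⟩
      rcases locate t ht with ⟨i, hi, rfl⟩ | ⟨l, r, h, hm⟩
      · rw [hct i hi] at hp
        exact notMem_range_of_mem_openSegment (hedge i hi) (hP i hi) ⟨p, hp⟩
      · exact notMem_latticeGrid_of_mem_openTriangle h hm (hp ▸ latticePt_mem_latticeGrid p)
    numCrossings := n
    time := time
    left := left
    right := right
    time_lt_time := fun i j hij _ => tlt i j hij
    crossing_times := by
      intro t ht
      constructor
      · intro hg
        rcases locate t ht with h | ⟨l, r, h, hm⟩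
        · exact h
        · exact absurd hg (notMem_latticeGrid_of_mem_openTriangle h hm)
      · rintro ⟨i, hi, rfl⟩
        rw [hct i hi]
        exact (hedge i hi).openSegment_subset_latticeGrid (hP i hi)
    time_mem := tm
    isLatticeEdge := hedge
    curve_time_mem := fun i hi => (hct i hi).symm ▸ hP i hi
    side_before := by
      intro i hi
      have : (i : ℝ) / (n + 1) < time i := div_lt_div_of_pos_right (by linarith) hpos
      filter_upwards [Ioo_mem_nhdsLT this] with t ht
      have := (cbefore i hi t ht.1 ht.2).1
      rw [sideOf_swap] at this
      linarith
    side_after := by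
      intro i hi
      filter_upwards [Ioo_mem_nhdsGT (tlt i (i + 1) (by omega))] with t ht
      exact (cafter i hi t ht.1 ht.2).1
    no_bigon := fun i hi => step_edge_ne (hedge i (by omega)) (hstep i hi)
    first_crossing := fun h => by
      rw [hA, Sym2.eq_swap]
      exact (hedge 0 h).symm.apex_notMem
    last_crossing := fun i hi => by
      rw [hB i hi]
      exact (hedge i (by omega)).apex_notMem }, rfl, rfl, rfl, hct⟩

/-- Two neighbouring lattice points are joined by an arc without crossings. -/
theorem exists_latticeArc_of_isLatticeEdge {A B : ℤ × ℤ} (h : IsLatticeEdge A B) :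
    ∃ δ : LatticeArc A B, δ.numCrossings = 0 := by
  -- A parabola in the triangle beyond the edge, which is tangent to the two other sides.
  set curve : ℝ → Plane := fun t => (1 - t) ^ 2 • latticePt A + t ^ 2 • latticePt B
    + (2 * t * (1 - t)) • latticePt (apex A B) with hcurve
  have hT : ∀ t ∈ Ioo (0 : ℝ) 1, curve t ∈ openTriangle A B := by
    rintro t ⟨h0, h1⟩
    have h1' : 0 < 1 - t := by linarith
    have h2 : 0 < t * (1 - t) := by positivity
    obtain ⟨a, b⟩ := A
    rcases h.cases with rfl | rfl | rfl | rfl | rfl | rfl <;>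
    · simp only [hcurve, openTriangle, sideOf, apex, mem_ofPred_eq, PiLp.add_apply,
        PiLp.smul_apply, latticePt_apply_zero, latticePt_apply_one, smul_eq_mul]
      push_cast
      refine ⟨?_, ?_, ?_⟩ <;> nlinarith
  have hg : ∀ t ∈ Ioo (0 : ℝ) 1, curve t ∉ latticeGrid := fun t ht =>
    notMem_latticeGrid_of_mem_openTriangle h (hT t ht)
  exact ⟨{
    curve := curve
    continuousOn_curve := by
      refine Continuous.continuousOn ?_
      fun_prop
    curve_zero := by simp [hcurve]
    curve_one := by simp [hcurve]
    curve_avoids := by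
      rintro t ht ⟨p, hp⟩
      exact hg t ht (hp ▸ latticePt_mem_latticeGrid p)
    numCrossings := 0
    time := fun _ => 0
    left := fun _ => A
    right := fun _ => A
    time_lt_time := fun i j _ hj => absurd hj (Nat.not_lt_zero j)
    crossing_times := fun t ht => ⟨fun h => absurd h (hg t ht), fun ⟨i, hi, _⟩ =>
      absurd hi (Nat.not_lt_zero i)⟩
    time_mem := fun i hi => absurd hi (Nat.not_lt_zero i)
    isLatticeEdge := fun i hi => absurd hi (Nat.not_lt_zero i)
    curve_time_mem := fun i hi => absurd hi (Nat.not_lt_zero i)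
    side_before := fun i hi => absurd hi (Nat.not_lt_zero i)
    side_after := fun i hi => absurd hi (Nat.not_lt_zero i)
    no_bigon := fun i hi => absurd hi (Nat.not_lt_zero _)
    first_crossing := fun hi => absurd hi (Nat.not_lt_zero 0)
    last_crossing := fun i hi => absurd hi (Nat.succ_ne_zero i) }, rfl⟩

/-! ### Collapsing a part of a fence -/

namespace WeightedFence

/-- The element at position `i`. -/
def elem (P : WeightedFence) (i : ℕ) (h : i < P.size) : P.Elem := (⟨i, h⟩ : Fin P.size)

@[simp] theorem idx_elem (P : WeightedFence) (i : ℕ) (h : i < P.size) : (P.elem i h).idx = i := rfl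

theorem idx_lt {P : WeightedFence} (x : P.Elem) : x.idx < P.size := Fin.isLt x

theorem idx_injective {P : WeightedFence} : Function.Injective (Elem.idx (P := P)) :=
  fun _ _ h => Fin.ext h

open Classical in
/-- The order ideals, as finite sets of elements. -/
noncomputable def ideals (P : WeightedFence) : Finset (Finset P.Elem) :=
  Finset.filter (fun I : Finset P.Elem => IsLowerSet (I : Set P.Elem)) Finset.univ

theorem mem_ideals {P : WeightedFence} {I : Finset P.Elem} :
    I ∈ P.ideals ↔ IsLowerSet (I : Set P.Elem) := by
  simp [ideals]

/-- In the definition of the weight sum the order ideals occur as sets. -/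
theorem weightSum_eq (P : WeightedFence) :
    P.weightSum = ∑ I ∈ P.ideals, ∏ x ∈ I, P.weight x.idx := by
  classical
  symm
  refine Finset.sum_bij (fun I _ => (I : Set P.Elem)) ?_ ?_ ?_ ?_
  · intro I hI
    refine Finset.mem_filter.2 ⟨?_, mem_ideals.1 hI⟩
    change _ ∈ Finset.sup Finset.univ fun J : Finset P.Elem => ({(J : Set P.Elem)} : Finset _)
    exact Finset.mem_sup.2 ⟨I, Finset.mem_univ _, Finset.mem_singleton_self _⟩
  · exact fun I _ J _ h => Finset.coe_injective h
  · intro J hJ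
    obtain ⟨h1, h2⟩ := Finset.mem_filter.1 hJ
    exact ⟨J.toFinset, mem_ideals.2 (by simpa using h2), by simp⟩
  · intro I _
    refine Finset.prod_congr ?_ fun _ _ => rfl
    ext
    simp
theorem weightSum_pos (P : WeightedFence) (hpos : ∀ i < P.size, 0 < P.weight i) :
    0 < P.weightSum := by
  classical
  rw [weightSum_eq]
  refine Finset.sum_pos (fun I _ => Finset.prod_pos fun x _ => hpos _ (idx_lt x)) ⟨∅, ?_⟩
  simp [mem_ideals, isLowerSet_empty]

theorem weightSum_of_size_eq_zero (P : WeightedFence) (h : P.size = 0) : P.weightSum = 1 := by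
  classical
  have : IsEmpty P.Elem := ⟨fun x => absurd (idx_lt x) (by omega)⟩
  rw [weightSum_eq, Finset.sum_eq_single ∅]
  · rw [Finset.prod_empty]
  · intro I _ hI
    exact absurd (Finset.eq_empty_of_isEmpty I) hI
  · intro h
    simp [mem_ideals, isLowerSet_empty] at h

theorem one_lt_weightSum (P : WeightedFence) (h : 0 < P.size)
    (hpos : ∀ i < P.size, 0 < P.weight i) : 1 < P.weightSum := by
  classical
  have h1 : ∑ I ∈ {(∅ : Finset P.Elem)}, ∏ x ∈ I, P.weight x.idx = 1 := by simp
  rw [weightSum_eq, ← h1]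
  refine Finset.sum_lt_sum_of_subset (i := Finset.univ) ?_ ?_ ?_ ?_ ?_
  · simp [mem_ideals, isLowerSet_empty]
  · simp [mem_ideals, isLowerSet_univ]
  · simp only [Finset.mem_singleton]
    exact Finset.nonempty_iff_ne_empty.1 ⟨P.elem 0 h, Finset.mem_univ _⟩
  · exact Finset.prod_pos fun x _ => hpos _ (idx_lt x)
  · exact fun I _ _ => (Finset.prod_pos fun x _ => hpos _ (idx_lt x)).le

/-- If a fence `Q` is a retract of `P` and the elements of `P` outside `Q` can be paired off, in
such a way that the weights in a pair cancel and both are retracted to the same element, then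
taking preimages embeds the order ideals of `Q` into those of `P` and preserves their weights.
Some order ideal of `P` is missed, because it separates an element from its image in `Q`. -/
theorem weightSum_lt_of_retract {P Q : WeightedFence} (g : P.Elem → Q.Elem) (hg : Monotone g)
    (s : Q.Elem → P.Elem) (hs : ∀ y, g (s y) = y)
    (hw : ∀ y, P.weight (s y).idx = Q.weight y.idx) (hpos : ∀ i < P.size, 0 < P.weight i)
    (τ : P.Elem → P.Elem) (hττ : ∀ x, τ (τ x) = x) (hτs : ∀ x, x ∉ range s → τ x ∉ range s)
    (hτg : ∀ x, x ∉ range s → g (τ x) = g x)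
    (hτw : ∀ x, x ∉ range s → P.weight x.idx * P.weight (τ x).idx = 1)
    (hτ : ∀ x, x ∉ range s → P.weight x.idx ≠ 1 → τ x ≠ x) (hne : ∃ x, x ∉ range s) :
    Q.weightSum < P.weightSum := by
  classical
  have hsinj : Function.Injective s := fun y z h => by rw [← hs y, ← hs z, h]
  let pre : Finset Q.Elem → Finset P.Elem := fun I => Finset.univ.filter fun x => g x ∈ I
  have hpre : ∀ I x, x ∈ pre I ↔ g x ∈ I := fun I x => by simp [pre]
  have hpinj : Function.Injective pre := by
    intro I J h
    ext y
    have := Finset.ext_iff.1 h (s y)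
    rwa [hpre, hpre, hs] at this
  have hprod : ∀ I, ∏ x ∈ pre I, P.weight x.idx = ∏ y ∈ I, Q.weight y.idx := by
    intro I
    rw [← Finset.prod_filter_mul_prod_filter_not (pre I) (fun x => x ∈ range s)]
    have h1 : (pre I).filter (fun x => x ∈ range s) = I.image s := by
      ext x
      simp only [Finset.mem_filter, hpre, Finset.mem_image, mem_range]
      constructor
      · rintro ⟨h, y, rfl⟩
        exact ⟨y, by rwa [hs] at h, rfl⟩
      · rintro ⟨y, hy, rfl⟩
        exact ⟨by rwa [hs], y, rfl⟩
    have h2 : ∏ x ∈ (pre I).filter (fun x => ¬ x ∈ range s), P.weight x.idx = 1 := by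
      refine Finset.prod_involution (fun x _ => τ x) ?_ ?_ ?_ ?_
      · exact fun x hx => hτw x (Finset.mem_filter.1 hx).2
      · exact fun x hx => hτ x (Finset.mem_filter.1 hx).2
      · intro x hx
        obtain ⟨a, b⟩ := Finset.mem_filter.1 hx
        refine Finset.mem_filter.2 ⟨(hpre _ _).2 ?_, hτs x b⟩
        rw [hτg x b]
        exact (hpre _ _).1 a
      · exact fun x _ => hττ x
    rw [h1, h2, mul_one, Finset.prod_image fun y _ z _ h => hsinj h]
    exact Finset.prod_congr rfl fun y _ => hw y
  obtain ⟨x, hx⟩ := hne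
  have hgx : g (s (g x)) = g x := hs _
  have hxx : s (g x) ≠ x := fun h => hx ⟨g x, h⟩
  obtain ⟨a, b, hab, hnab⟩ : ∃ a b, g a = g b ∧ ¬ a ≤ b := by
    by_cases h : x ≤ s (g x)
    · exact ⟨s (g x), x, hgx, fun h' => hxx (le_antisymm h' h)⟩
    · exact ⟨x, s (g x), hgx.symm, h⟩
  rw [weightSum_eq, weightSum_eq, ← Finset.sum_congr rfl fun I _ => hprod I,
    ← Finset.sum_image (f := fun J => ∏ x ∈ J, P.weight x.idx) fun I _ J _ h => hpinj h]
  refine Finset.sum_lt_sum_of_subset (i := Finset.univ.filter fun y => y ≤ b) ?_ ?_ ?_ ?_ ?_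
  · intro J hJ
    obtain ⟨I, hI, rfl⟩ := Finset.mem_image.1 hJ
    refine mem_ideals.2 fun u v hvu hu => ?_
    exact (hpre _ _).2 (mem_ideals.1 hI (hg hvu) ((hpre _ _).1 hu))
  · refine mem_ideals.2 fun u v hvu hu => ?_
    simp only [Finset.coe_filter, Finset.mem_univ, true_and, mem_ofPred_eq] at hu ⊢
    exact hvu.trans hu
  · intro hJ
    obtain ⟨I, -, hI⟩ := Finset.mem_image.1 hJ
    have hb : b ∈ pre I := by rw [hI]; simp
    have ha : a ∈ pre I := (hpre _ _).2 (hab ▸ (hpre _ _).1 hb)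
    rw [hI] at ha
    exact hnab (by simpa using ha)
  · exact Finset.prod_pos fun x _ => hpos _ (idx_lt x)
  · exact fun I _ _ => (Finset.prod_pos fun x _ => hpos _ (idx_lt x)).le

/-- Removing the elements `a, …, b - 1` from a fence decreases its weight sum if they can be paired
off with cancelling weights and if the relation that is created between the neighbours `a - 1` and
`b` agrees with the one between `c - 1` and `c` for some `a ≤ c ≤ b`. The elements before `c` are
collapsed to `a - 1`, the others to `b`. -/
theorem weightSum_lt_of_collapse {P Q : WeightedFence} {a b c : ℕ} (hab : a < b) (hb : b ≤ P.size)
    (hQ : Q.size + (b - a) = P.size) (hac : a ≤ c) (hcb : c ≤ b) (hc0 : a = 0 → c = 0)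
    (hcN : b = P.size → c = b) (hpos : ∀ i < P.size, 0 < P.weight i)
    (hasc1 : ∀ x, x + 1 < a → (Q.Ascends x ↔ P.Ascends x))
    (hasc2 : ∀ x, a ≤ x → x + 1 < Q.size → (Q.Ascends x ↔ P.Ascends (x + (b - a))))
    (hasc3 : 0 < a → b < P.size → (Q.Ascends (a - 1) ↔ P.Ascends (c - 1)))
    (hw1 : ∀ x < a, P.weight x = Q.weight x)
    (hw2 : ∀ x, a ≤ x → x < Q.size → P.weight (x + (b - a)) = Q.weight x)
    (τ : ℕ → ℕ) (hττ : ∀ x, τ (τ x) = x) (hτ1 : ∀ x, a ≤ x → x < b → a ≤ τ x ∧ τ x < b)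
    (hτc : ∀ x, x < c ↔ τ x < c) (hτw : ∀ x, a ≤ x → x < b → P.weight x * P.weight (τ x) = 1)
    (hτ : ∀ x, a ≤ x → x < b → P.weight x ≠ 1 → τ x ≠ x) : Q.weightSum < P.weightSum := by
  rcases Nat.eq_zero_or_pos Q.size with hQ0 | hQ0
  · rw [weightSum_of_size_eq_zero Q hQ0]
    exact one_lt_weightSum P (by omega) hpos
  let G : ℕ → ℕ := fun x => if x < c then min x (a - 1) else max x b - (b - a)
  have hG : ∀ x < P.size, G x < Q.size := by
    intro x hx
    simp only [G]
    split_ifs <;> omega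
  let S : ℕ → ℕ := fun x => if x < a then x else x + (b - a)
  have hS : ∀ x < Q.size, S x < P.size := by
    intro x hx
    simp only [S]
    split_ifs <;> omega
  have hGS : ∀ x < Q.size, G (S x) = x := by
    intro x hx
    simp only [G, S]
    split_ifs <;> omega
  have hstep : ∀ z, z + 1 < P.size → G (z + 1) = G z ∨
      (G (z + 1) = G z + 1 ∧ (P.Ascends z ↔ Q.Ascends (G z))) := by
    intro z hz
    rcases lt_trichotomy (z + 1) c with h | h | h
    · have e1 : G z = min z (a - 1) := if_pos (by omega)
      have e2 : G (z + 1) = min (z + 1) (a - 1) := if_pos (by omega)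
      rcases Nat.lt_or_ge (z + 1) a with h' | h'
      · right
        have e3 : G z = z := by omega
        exact ⟨by omega, by rw [e3, hasc1 z h']⟩
      · left
        omega
    · have e1 : G z = min z (a - 1) := if_pos (by omega)
      have e2 : G (z + 1) = max (z + 1) b - (b - a) := if_neg (by omega)
      have e3 : G z = a - 1 := by omega
      refine Or.inr ⟨by omega, ?_⟩
      rw [e3, hasc3 (by omega) (by omega), ← h, Nat.add_sub_cancel]
    · have e1 : G z = max z b - (b - a) := if_neg (by omega)
      have e2 : G (z + 1) = max (z + 1) b - (b - a) := if_neg (by omega)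
      rcases Nat.lt_or_ge z b with h' | h'
      · left
        omega
      · right
        refine ⟨by omega, ?_⟩
        have e3 : G z + (b - a) = z := by omega
        rw [hasc2 (G z) (by omega) (by omega), e3]
  have hτlt : ∀ x, a ≤ x ∧ x < b → τ x < P.size := fun x hx => (hτ1 x hx.1 hx.2).2.trans_le hb
  let τ' : P.Elem → P.Elem := fun x =>
    if h : a ≤ x.idx ∧ x.idx < b then P.elem (τ x.idx) (hτlt _ h) else x
  let s : Q.Elem → P.Elem := fun y => P.elem (S y.idx) (hS _ (idx_lt y))
  have hrange : ∀ x, x ∉ range s ↔ a ≤ x.idx ∧ x.idx < b := by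
    intro x
    constructor
    · intro hx
      by_contra hc
      refine hx ⟨Q.elem (if x.idx < a then x.idx else x.idx - (b - a)) ?_, idx_injective ?_⟩
      · have := idx_lt x
        split_ifs <;> omega
      · simp only [s, S, idx_elem]
        split_ifs <;> omega
    · rintro ⟨h1, h2⟩ ⟨y, rfl⟩
      simp only [s, S, idx_elem] at h1 h2
      split_ifs at h1 h2 <;> omega
  have hτ' : ∀ x, a ≤ x.idx ∧ x.idx < b → (τ' x).idx = τ x.idx := fun x hx => by
    simp only [τ', dif_pos hx, idx_elem]
  refine weightSum_lt_of_retract (fun x => Q.elem (G x.idx) (hG _ (idx_lt x))) ?_ s ?_ ?_ hpos τ'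
    ?_ ?_ ?_ ?_ ?_ ?_
  · intro x y hxy
    have hxy' : Relation.ReflTransGen P.Below x y := hxy
    induction hxy' with
    | refl => exact le_rfl
    | @tail y z hy hyz ih =>
      refine (ih hy).trans ?_
      rcases hyz with ⟨h1, h2⟩ | ⟨h1, h2⟩
      · rcases hstep y.idx (h1 ▸ idx_lt z) with e | ⟨e, e'⟩
        · exact le_of_eq (idx_injective (by rw [idx_elem, idx_elem, h1, e]))
        · refine Relation.ReflTransGen.single (Or.inl ⟨?_, ?_⟩)
          · rw [idx_elem, idx_elem, h1, e]
          · rw [idx_elem]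
            exact e'.1 h2
      · rcases hstep z.idx (h1 ▸ idx_lt y) with e | ⟨e, e'⟩
        · exact le_of_eq (idx_injective (by rw [idx_elem, idx_elem, h1, e]))
        · refine Relation.ReflTransGen.single (Or.inr ⟨?_, ?_⟩)
          · rw [idx_elem, idx_elem, h1, e]
          · rw [idx_elem]
            exact mt e'.2 h2
  · intro y
    exact idx_injective (hGS _ (idx_lt y))
  · intro y
    simp only [s, S, idx_elem]
    split_ifs with h
    · exact hw1 _ h
    · exact hw2 _ (not_lt.1 h) (idx_lt y)
  · intro x
    by_cases hx : a ≤ x.idx ∧ x.idx < b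
    · apply idx_injective
      rw [hτ' _ (by rw [hτ' x hx]; exact hτ1 _ hx.1 hx.2), hτ' x hx, hττ]
    · simp only [τ', dif_neg hx]
  · intro x hx
    rw [hrange] at hx ⊢
    rw [hτ' x hx]
    exact hτ1 _ hx.1 hx.2
  · intro x hx
    rw [hrange] at hx
    apply idx_injective
    have h := hτ1 _ hx.1 hx.2
    have hc := hτc x.idx
    simp only [idx_elem, hτ' x hx, G]
    split_ifs <;> omega
  · intro x hx
    rw [hrange] at hx
    rw [hτ' x hx]
    exact hτw _ hx.1 hx.2
  · intro x hx h1 h2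
    rw [hrange] at hx
    refine hτ _ hx.1 hx.2 h1 ?_
    rw [← hτ' x hx, h2]
  · refine ⟨P.elem a (by omega), (hrange _).2 ⟨le_rfl, ?_⟩⟩
    simpa using hab

end WeightedFence

namespace WeightedFence

/-- If the elements `2 * i` and `2 * i + 1` of a fence always contribute a natural number to the
weight of an order ideal, then the weight sum is a natural number. -/
theorem exists_natCast_eq_weightSum (P : WeightedFence) {n : ℕ} (hn : P.size = 2 * n)
    (h : ∀ i < n, ∀ x y : P.Elem, x.idx = 2 * i → y.idx = 2 * i + 1 → ∀ I ∈ P.ideals,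
      ∃ m : ℕ, (m : ℝ) = (if x ∈ I then P.weight (2 * i) else 1) *
        (if y ∈ I then P.weight (2 * i + 1) else 1)) :
    ∃ m : ℕ, (m : ℝ) = P.weightSum := by
  rw [weightSum_eq]
  suffices key : ∀ I ∈ P.ideals, ∃ m : ℕ, (m : ℝ) = ∏ x ∈ I, P.weight x.idx by
    choose! f hf using key
    exact ⟨∑ I ∈ P.ideals, f I, by rw [Nat.cast_sum]; exact Finset.sum_congr rfl hf⟩
  intro I hI
  rw [← Finset.prod_fiberwise_of_maps_to (s := I) (t := Finset.range n) (g := fun x => x.idx / 2)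
    (fun x _ => by have := idx_lt x; rw [Finset.mem_range]; omega)]
  have key : ∀ i ∈ Finset.range n, ∃ m : ℕ,
      (m : ℝ) = ∏ x ∈ I with x.idx / 2 = i, P.weight x.idx := by
    intro i hi
    rw [Finset.mem_range] at hi
    obtain ⟨m, hm⟩ := h i hi (P.elem (2 * i) (by omega)) (P.elem (2 * i + 1) (by omega)) rfl rfl
      I hI
    refine ⟨m, hm.trans ?_⟩
    have : I.filter (fun x => x.idx / 2 = i) =
        ({P.elem (2 * i) (by omega), P.elem (2 * i + 1) (by omega)} : Finset P.Elem).filter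
          (· ∈ I) := by
      ext x
      simp only [Finset.mem_filter, Finset.mem_insert, Finset.mem_singleton,
        ← idx_injective.eq_iff, idx_elem]
      constructor
      · rintro ⟨h1, h2⟩
        exact ⟨by omega, h1⟩
      · rintro ⟨h1, h2⟩
        exact ⟨h2, by omega⟩
    rw [this, Finset.prod_filter, Finset.prod_pair]
    · rfl
    · rw [Ne, ← idx_injective.eq_iff, idx_elem, idx_elem]
      omega
  choose! f hf using key
  exact ⟨∏ i ∈ Finset.range n, f i, by rw [Nat.cast_prod]; exact Finset.prod_congr rfl hf⟩

end WeightedFence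

namespace LatticeArc

variable {A B : ℤ × ℤ}

/-! ### Markov lengths -/

theorem fence_zero (γ : LatticeArc A B) : γ.fence 0 =
    { size := γ.numCrossings
      Ascends := fun j => ¬ γ.SharesRight j
      weight := fun _ => 1 } :=
  if_pos rfl

open Classical in
theorem fence_of_ne_zero (γ : LatticeArc A B) {k : ℕ} (hk : k ≠ 0) : γ.fence k =
    { size := 2 * γ.numCrossings
      Ascends := fun j =>
        if j % 2 = 0 then ¬ γ.CloserToRight (j / 2) else ¬ γ.SharesRight (j / 2)
      weight := fun j =>
        if j % 2 = 0 then
          if γ.CloserToRight (j / 2) then 1 / (k : ℝ) else (k : ℝ)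
        else
          if γ.CloserToRight (j / 2) then (k : ℝ) else 1 / (k : ℝ) } :=
  if_neg hk

theorem fence_weight_pos (γ : LatticeArc A B) (k i : ℕ) : 0 < (γ.fence k).weight i := by
  rcases eq_or_ne k 0 with rfl | hk
  · rw [fence_zero]
    exact one_pos
  · rw [fence_of_ne_zero γ hk]
    have : (0 : ℝ) < k := by positivity
    dsimp only
    split_ifs <;> positivity

theorem fence_size_of_ne_zero (γ : LatticeArc A B) {k : ℕ} (hk : k ≠ 0) :
    (γ.fence k).size = 2 * γ.numCrossings := by
  rw [fence_of_ne_zero γ hk]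

theorem fence_ascends_iff (γ : LatticeArc A B) {k : ℕ} (hk : k ≠ 0) (j : ℕ) :
    (γ.fence k).Ascends j ↔
      if j % 2 = 0 then ¬ γ.CloserToRight (j / 2) else ¬ γ.SharesRight (j / 2) := by
  rw [fence_of_ne_zero γ hk]

theorem fence_weight_eq {γ δ : LatticeArc A B} {k : ℕ} (hk : k ≠ 0) {x y : ℕ}
    (hxy : x % 2 = y % 2) (h : γ.CloserToRight (x / 2) ↔ δ.CloserToRight (y / 2)) :
    (γ.fence k).weight x = (δ.fence k).weight y := by
  rw [fence_of_ne_zero γ hk, fence_of_ne_zero δ hk]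
  dsimp only
  rw [hxy]
  by_cases hc : γ.CloserToRight (x / 2)
  · rw [if_pos hc, if_pos hc, if_pos (h.1 hc), if_pos (h.1 hc)]
  · rw [if_neg hc, if_neg hc, if_neg (mt h.2 hc), if_neg (mt h.2 hc)]

/-- The involution of `ℕ` that exchanges `2 * i` and `2 * i + 1`. -/
def pairSwap (x : ℕ) : ℕ := if x % 2 = 0 then x + 1 else x - 1

theorem pairSwap_pairSwap (x : ℕ) : pairSwap (pairSwap x) = x := by
  unfold pairSwap
  split_ifs <;> omega

theorem fence_weight_mul_pairSwap (γ : LatticeArc A B) {k : ℕ} (hk : k ≠ 0) (x : ℕ) :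
    (γ.fence k).weight x * (γ.fence k).weight (pairSwap x) = 1 := by
  have hk' : (k : ℝ) ≠ 0 := by exact_mod_cast hk
  rw [fence_of_ne_zero γ hk]
  dsimp only
  by_cases h : x % 2 = 0
  · have h0 : pairSwap x = x + 1 := if_pos h
    have h1 : ¬ (x + 1) % 2 = 0 := by omega
    have h2 : (x + 1) / 2 = x / 2 := by omega
    rw [h0, if_pos h, if_neg h1, h2]
    split_ifs <;> field_simp
  · have h0 : pairSwap x = x - 1 := if_neg h
    have h1 : (x - 1) % 2 = 0 := by omega
    have h2 : (x - 1) / 2 = x / 2 := by omega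
    rw [h0, if_neg h, if_pos h1, h2]
    split_ifs <;> field_simp

theorem fence_size_pos_iff (γ : LatticeArc A B) (k : ℕ) :
    0 < (γ.fence k).size ↔ 0 < γ.numCrossings := by
  rcases eq_or_ne k 0 with rfl | hk
  · rw [fence_zero]
  · rw [fence_of_ne_zero γ hk]
    dsimp only
    omega

theorem markovLength_pos (γ : LatticeArc A B) (k : ℕ) : 0 < γ.markovLength k :=
  (γ.fence k).weightSum_pos fun i _ => γ.fence_weight_pos k i

/-- Markov lengths are natural numbers: the two elements coming from a crossing contribute a
factor `1`, `k` or `k * (1 / k)` to the weight of an order ideal. -/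
theorem exists_natCast_eq_markovLength (γ : LatticeArc A B) (k : ℕ) :
    ∃ m : ℕ, (m : ℝ) = γ.markovLength k := by
  rcases eq_or_ne k 0 with rfl | hk
  · rw [markovLength, fence_zero, WeightedFence.weightSum_eq]
    exact ⟨_, by simp only [Finset.prod_const_one, Finset.sum_const, nsmul_eq_mul, mul_one]; rfl⟩
  · have hk' : (k : ℝ) ≠ 0 := by exact_mod_cast hk
    refine WeightedFence.exists_natCast_eq_weightSum _ (n := γ.numCrossings)
      (by rw [fence_of_ne_zero γ hk]) ?_
    rw [fence_of_ne_zero γ hk]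
    intro i hi x y hx hy I hI
    have hI := WeightedFence.mem_ideals.1 hI
    have e1 : 2 * i % 2 = 0 := by omega
    have e2 : ¬ (2 * i + 1) % 2 = 0 := by omega
    have e3 : 2 * i / 2 = i := by omega
    have e4 : (2 * i + 1) / 2 = i := by omega
    simp only [e1, e2, if_true, if_false]
    by_cases hc : γ.CloserToRight i
    · have hyx : y ≤ x := by
        refine Relation.ReflTransGen.single (Or.inr ⟨by omega, ?_⟩)
        simp [hx, e1, e3, hc]
      rw [if_pos (show γ.CloserToRight (2 * i / 2) from e3.symm ▸ hc),
        if_pos (show γ.CloserToRight ((2 * i + 1) / 2) from e4.symm ▸ hc)]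
      by_cases h1 : x ∈ I
      · have h2 : y ∈ I := hI hyx h1
        exact ⟨1, by simp [h1, h2, hk']⟩
      · by_cases h2 : y ∈ I
        · exact ⟨k, by simp [h1, h2]⟩
        · exact ⟨1, by simp [h1, h2]⟩
    · have hxy : x ≤ y := by
        refine Relation.ReflTransGen.single (Or.inl ⟨by omega, ?_⟩)
        simp [hx, e1, e3, hc]
      rw [if_neg (show ¬ γ.CloserToRight (2 * i / 2) from e3.symm ▸ hc),
        if_neg (show ¬ γ.CloserToRight ((2 * i + 1) / 2) from e4.symm ▸ hc)]
      by_cases h1 : y ∈ I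
      · have h2 : x ∈ I := hI hxy h1
        exact ⟨1, by simp [h1, h2, hk']⟩
      · by_cases h2 : x ∈ I
        · exact ⟨k, by simp [h1, h2]⟩
        · exact ⟨1, by simp [h1, h2]⟩

/-! ### Removing consecutive crossings -/

/-- The relation created by leaving out crossings already occurs in the part left out: if all
segments in this part shared endpoints on the right, then it would be one and the same endpoint,
also of the two segments that become neighbours; and likewise on the left. -/
theorem exists_sharesRight_iff (γ δ : LatticeArc A B) {i j : ℕ} (hij : i < j)
    (hj : j + 1 < γ.numCrossings) (hi : i + 1 < δ.numCrossings)
    (hl : δ.left i = γ.left i) (hr : δ.right i = γ.right i)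
    (hl' : δ.left (i + 1) = γ.left (j + 1)) (hr' : δ.right (i + 1) = γ.right (j + 1)) :
    ∃ c, i ≤ c ∧ c ≤ j ∧ (δ.SharesRight i ↔ γ.SharesRight c) := by
  by_contra! hc
  by_cases hδ : δ.SharesRight i
  · have hleft : ∀ m, i ≤ m → m ≤ j + 1 → γ.left m = γ.left i := by
      intro m him
      induction m, him using Nat.le_induction with
      | base => exact fun _ => rfl
      | succ m him ih =>
        intro hm
        have h1 := hc m him (by omega)
        rcases γ.step (i := m) (by omega) with ⟨e, -⟩ | ⟨-, e⟩
        · rw [e, ih (by omega)]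
        · have : γ.SharesRight m := e.symm
          tauto
    refine δ.no_bigon i hi ?_
    have e : δ.right i = δ.right (i + 1) := hδ
    rw [← e, hl', hl, hleft (j + 1) (by omega) le_rfl]
  · have hright : ∀ m, i ≤ m → m ≤ j + 1 → γ.right m = γ.right i := by
      intro m him
      induction m, him using Nat.le_induction with
      | base => exact fun _ => rfl
      | succ m him ih =>
        intro hm
        have h1 := hc m him (by omega)
        have : γ.SharesRight m := by tauto
        rw [← ih (by omega)]
        exact this.symm
    exact hδ (by rw [SharesRight, hr, hr', hright (j + 1) (by omega) le_rfl])

/-- An arc that arises by leaving out the crossings `i, …, j - 1` is shorter. -/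
theorem markovLength_lt_of_removal (γ δ : LatticeArc A B) {i j : ℕ} (hij : i < j)
    (hj : j ≤ γ.numCrossings) (hn : δ.numCrossings + (j - i) = γ.numCrossings)
    (hl1 : ∀ m < i, δ.left m = γ.left m) (hr1 : ∀ m < i, δ.right m = γ.right m)
    (hc1 : ∀ m < i, δ.curve (δ.time m) = γ.curve (γ.time m))
    (hl2 : ∀ m, i ≤ m → m < δ.numCrossings → δ.left m = γ.left (m + (j - i)))
    (hr2 : ∀ m, i ≤ m → m < δ.numCrossings → δ.right m = γ.right (m + (j - i)))
    (hc2 : ∀ m, i ≤ m → m < δ.numCrossings →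
      δ.curve (δ.time m) = γ.curve (γ.time (m + (j - i)))) (k : ℕ) :
    δ.markovLength k < γ.markovLength k := by
  -- The cut for collapsing the removed part of the fence: it agrees with the new relation.
  obtain ⟨c, hc1', hc2', hc0, hcn, hcut⟩ : ∃ c, i ≤ c ∧ c ≤ j ∧ (i = 0 → c = 0) ∧
      (j = γ.numCrossings → c = j ∨ δ.numCrossings = 0) ∧
      (0 < i → j < γ.numCrossings → 0 < c ∧ (δ.SharesRight (i - 1) ↔ γ.SharesRight (c - 1))) := by
    rcases Nat.eq_zero_or_pos i with rfl | hi
    · exact ⟨0, le_rfl, by omega, fun _ => rfl, fun _ => Or.inr (by omega),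
        fun h => absurd h (lt_irrefl 0)⟩
    rcases hj.eq_or_lt with hj | hj
    · exact ⟨j, hij.le, le_rfl, by omega, fun _ => Or.inl rfl, fun _ h => by omega⟩
    · obtain ⟨i, rfl⟩ : ∃ i', i = i' + 1 := ⟨i - 1, by omega⟩
      obtain ⟨j, rfl⟩ : ∃ j', j = j' + 1 := ⟨j - 1, by omega⟩
      have hsum : i + 1 + (j + 1 - (i + 1)) = j + 1 := by omega
      obtain ⟨c, h1, h2, h3⟩ := γ.exists_sharesRight_iff δ (i := i) (j := j) (by omega) hj
        (by omega) (hl1 i (by omega)) (hr1 i (by omega))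
        (by rw [hl2 (i + 1) le_rfl (by omega), hsum])
        (by rw [hr2 (i + 1) le_rfl (by omega), hsum])
      exact ⟨c + 1, by omega, by omega, by omega, by omega, fun _ _ => ⟨by omega, h3⟩⟩
  have hclose1 : ∀ m < i, (δ.CloserToRight m ↔ γ.CloserToRight m) := fun m hm => by
    rw [CloserToRight, CloserToRight, hl1 m hm, hr1 m hm, hc1 m hm]
  have hclose2 : ∀ m, i ≤ m → m < δ.numCrossings →
      (δ.CloserToRight m ↔ γ.CloserToRight (m + (j - i))) := fun m hm hm' => by
    rw [CloserToRight, CloserToRight, hl2 m hm hm', hr2 m hm hm', hc2 m hm hm']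
  have hshare1 : ∀ m, m + 1 < i → (δ.SharesRight m ↔ γ.SharesRight m) := fun m hm => by
    rw [SharesRight, SharesRight, hr1 m (by omega), hr1 (m + 1) hm]
  have hshare2 : ∀ m, i ≤ m → m + 1 < δ.numCrossings →
      (δ.SharesRight m ↔ γ.SharesRight (m + (j - i))) := fun m hm hm' => by
    rw [SharesRight, SharesRight, hr2 m hm (by omega), hr2 (m + 1) (by omega) hm',
      show m + 1 + (j - i) = m + (j - i) + 1 by omega]
  rcases Nat.eq_zero_or_pos δ.numCrossings with hδ | hδ
  · rw [markovLength, markovLength, WeightedFence.weightSum_of_size_eq_zero]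
    · exact WeightedFence.one_lt_weightSum _ ((fence_size_pos_iff _ _).2 (by omega))
        fun x _ => γ.fence_weight_pos k x
    · exact Nat.eq_zero_of_not_pos fun h => by
        rw [fence_size_pos_iff] at h
        omega
  have hpos := fun x (_ : x < (γ.fence k).size) => γ.fence_weight_pos k x
  rw [markovLength, markovLength]
  rcases eq_or_ne k 0 with rfl | hk
  · rw [fence_zero] at hpos
    rw [fence_zero, fence_zero]
    refine WeightedFence.weightSum_lt_of_collapse (a := i) (b := j) (c := c) hij hj hn hc1' hc2' hc0
      ?_ hpos ?_ ?_ ?_ (fun _ _ => rfl) (fun _ _ _ => rfl) id (fun _ => rfl)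
      (fun x h1 h2 => ⟨h1, h2⟩) (fun _ => Iff.rfl) (fun _ _ _ => one_mul 1)
      (fun _ _ _ h => absurd rfl h)
    · intro h
      exact (hcn h).resolve_right hδ.ne'
    · exact fun x hx => not_congr (hshare1 x hx)
    · exact fun x hx hx' => not_congr (hshare2 x hx hx')
    · exact fun h h' => not_congr (hcut h h').2
  · have hd : 2 * j - 2 * i = 2 * (j - i) := by omega
    have hmod : ∀ x, (x + 2 * (j - i)) % 2 = x % 2 := fun x => by omega
    have hdiv : ∀ x, (x + 2 * (j - i)) / 2 = x / 2 + (j - i) := fun x => by omega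
    have hγs := γ.fence_size_of_ne_zero hk
    have hδs := δ.fence_size_of_ne_zero hk
    refine WeightedFence.weightSum_lt_of_collapse (a := 2 * i) (b := 2 * j) (c := 2 * c)
      (by omega) (by omega) (by omega) (by omega) (by omega) (by omega)
      ?_ hpos ?_ ?_ ?_ ?_ ?_ pairSwap pairSwap_pairSwap ?_ ?_ ?_ ?_
    · intro h
      rw [(hcn (by omega)).resolve_right hδ.ne']
    · intro x hx
      rw [fence_ascends_iff _ hk, fence_ascends_iff _ hk]
      split_ifs with h
      · exact not_congr (hclose1 _ (by omega))
      · exact not_congr (hshare1 _ (by omega))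
    · intro x hx hx'
      rw [fence_ascends_iff _ hk, fence_ascends_iff _ hk, hd, hmod, hdiv]
      split_ifs with h
      · exact not_congr (hclose2 _ (by omega) (by omega))
      · exact not_congr (hshare2 _ (by omega) (by omega))
    · intro h h'
      obtain ⟨h0, h1⟩ := hcut (by omega) (by omega)
      rw [fence_ascends_iff _ hk, fence_ascends_iff _ hk, if_neg (by omega), if_neg (by omega),
        show (2 * i - 1) / 2 = i - 1 by omega, show (2 * c - 1) / 2 = c - 1 by omega]
      exact not_congr h1
    · exact fun x hx => fence_weight_eq hk rfl (hclose1 (x / 2) (by omega)).symm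
    · intro x hx hx'
      refine fence_weight_eq hk (by omega) ?_
      rw [hd, hdiv]
      exact (hclose2 (x / 2) (by omega) (by omega)).symm
    · intro x hx hx'
      unfold pairSwap
      split_ifs <;> omega
    · intro x
      unfold pairSwap
      split_ifs <;> omega
    · exact fun x _ _ => γ.fence_weight_mul_pairSwap hk x
    · intro x _ _ _
      unfold pairSwap
      split_ifs <;> omega

/-- The crossings `i, …, j - 1` can be left out if the remaining ones fit together. -/
theorem exists_shortcut (γ : LatticeArc A B) {i j : ℕ} (hij : i < j) (hj : j ≤ γ.numCrossings)
    (hmid : 0 < i → j < γ.numCrossings →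
      (γ.left j = γ.left (i - 1) ∧ γ.right j = apex (γ.left (i - 1)) (γ.right (i - 1))) ∨
        (γ.left j = apex (γ.left (i - 1)) (γ.right (i - 1)) ∧ γ.right j = γ.right (i - 1)))
    (hA : i = 0 → j < γ.numCrossings → A = apex (γ.right j) (γ.left j))
    (hB : 0 < i → j = γ.numCrossings → B = apex (γ.left (i - 1)) (γ.right (i - 1)))
    (hAB : i = 0 → j = γ.numCrossings → IsLatticeEdge A B) :
    ∃ δ : LatticeArc A B, ∀ k, δ.markovLength k < γ.markovLength k := by
  by_cases hn : i = 0 ∧ j = γ.numCrossings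
  · obtain ⟨δ, hδ⟩ := exists_latticeArc_of_isLatticeEdge (hAB hn.1 hn.2)
    exact ⟨δ, γ.markovLength_lt_of_removal δ hij hj (by omega) (fun m hm => by omega)
      (fun m hm => by omega) (fun m hm => by omega) (fun m _ hm => by omega)
      (fun m _ hm => by omega) (fun m _ hm => by omega)⟩
  set σ : ℕ → ℕ := fun m => if m < i then m else m + (j - i) with hσ
  have σ1 : ∀ m < i, σ m = m := fun m hm => if_pos hm
  have σ2 : ∀ m, i ≤ m → σ m = m + (j - i) := fun m hm => if_neg (not_lt.2 hm)
  have hσlt : ∀ m < γ.numCrossings - (j - i), σ m < γ.numCrossings := by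
    intro m hm
    simp only [hσ]
    split_ifs <;> omega
  have hstep : ∀ m, m + 1 < γ.numCrossings - (j - i) →
      (γ.left (σ (m + 1)) = γ.left (σ m) ∧
        γ.right (σ (m + 1)) = apex (γ.left (σ m)) (γ.right (σ m))) ∨
      (γ.left (σ (m + 1)) = apex (γ.left (σ m)) (γ.right (σ m)) ∧
        γ.right (σ (m + 1)) = γ.right (σ m)) := by
    intro m hm
    rcases lt_trichotomy (m + 1) i with h | h | h
    · rw [σ1 m (by omega), σ1 (m + 1) h]
      exact γ.step (by omega)
    · have := hmid (by omega) (by omega)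
      rw [σ1 m (by omega), σ2 (m + 1) h.ge, show m + 1 + (j - i) = j by omega]
      rwa [show i - 1 = m by omega] at this
    · rw [σ2 m (by omega), σ2 (m + 1) h.le, show m + 1 + (j - i) = m + (j - i) + 1 by omega]
      exact γ.step (by omega)
  have hstart : A = apex (γ.right (σ 0)) (γ.left (σ 0)) := by
    rcases Nat.eq_zero_or_pos i with h | h
    · rw [σ2 0 (by omega), show 0 + (j - i) = j by omega]
      exact hA h (by omega)
    · rw [σ1 0 h]
      exact γ.start_eq_apex (by omega)
  have hend : ∀ m, m + 1 = γ.numCrossings - (j - i) →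
      B = apex (γ.left (σ m)) (γ.right (σ m)) := by
    intro m hm
    rcases Nat.lt_or_ge m i with h | h
    · have := hB (by omega) (by omega)
      rw [σ1 m h]
      rwa [show i - 1 = m by omega] at this
    · rw [σ2 m h]
      exact γ.end_eq_apex (by omega)
  obtain ⟨δ, hδn, hδl, hδr, hδc⟩ := exists_latticeArc (A := A) (B := B)
    (n := γ.numCrossings - (j - i)) (by omega) (left := fun m => γ.left (σ m))
    (right := fun m => γ.right (σ m)) (fun m hm => γ.isLatticeEdge _ (hσlt m hm)) hstep hstart hend
    (fun m => γ.curve (γ.time (σ m))) (fun m hm => γ.curve_time_mem _ (hσlt m hm))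
  exact ⟨δ, γ.markovLength_lt_of_removal δ hij hj (by omega)
    (fun m hm => by simp only [hδl, σ1 m hm]) (fun m hm => by simp only [hδr, σ1 m hm])
    (fun m hm => by rw [hδc m (by omega), σ1 m hm])
    (fun m hm _ => by simp only [hδl, σ2 m hm]) (fun m hm _ => by simp only [hδr, σ2 m hm])
    (fun m hm _ => by rw [hδc m (by omega), σ2 m hm])⟩

end LatticeArc

/-! ### Shortening an arc that visits a triangle twice -/

theorem triSum_rotate (l r : ℤ × ℤ) : triSum r (apex l r) = triSum l r := by
  rw [triSum, triSum, apex_right_apex]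
  abel

/-- The label of a triangle determines its sides, with their orientation. -/
theorem eq_of_triSum_eq {l r p q : ℤ × ℤ} (h : IsLatticeEdge l r) (h' : IsLatticeEdge p q)
    (e : triSum p q = triSum l r) :
    (p = l ∧ q = r) ∨ (p = r ∧ q = apex l r) ∨ (p = apex l r ∧ q = l) := by
  obtain ⟨a, b⟩ := l
  obtain ⟨c, d⟩ := p
  simp only [triSum, apex, Prod.ext_iff, Prod.fst_add, Prod.snd_add] at e ⊢
  rcases h.cases with rfl | rfl | rfl | rfl | rfl | rfl <;>
  rcases h'.cases with rfl | rfl | rfl | rfl | rfl | rfl <;>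
  · dsimp only at e ⊢
    omega

/-- `p` is a vertex of the triangle with the label `c`. -/
def IsVertexOf (p c : ℤ × ℤ) : Prop := ∃ q, IsLatticeEdge p q ∧ triSum p q = c

theorem IsVertexOf.eq_or {p l r : ℤ × ℤ} (h : IsLatticeEdge l r) (hp : IsVertexOf p (triSum l r)) :
    p = l ∨ p = r ∨ p = apex l r := by
  obtain ⟨q, hq, e⟩ := hp
  have := eq_of_triSum_eq h hq e
  tauto

theorem isVertexOf_left {l r : ℤ × ℤ} (h : IsLatticeEdge l r) : IsVertexOf l (triSum l r) :=
  ⟨r, h, rfl⟩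

theorem isVertexOf_right {l r : ℤ × ℤ} (h : IsLatticeEdge l r) : IsVertexOf r (triSum l r) :=
  ⟨apex l r, h.right_apex, triSum_rotate l r⟩

theorem isVertexOf_apex {l r : ℤ × ℤ} (h : IsLatticeEdge l r) :
    IsVertexOf (apex l r) (triSum l r) :=
  ⟨l, h.apex_left, by rw [← triSum_rotate l r, ← triSum_rotate r, apex_right_apex]⟩

theorem IsVertexOf.eq_apex {p l r : ℤ × ℤ} (h : IsLatticeEdge l r)
    (hp : IsVertexOf p (triSum l r)) (hp' : ¬ IsVertexOf p (triSum r l)) : p = apex l r := by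
  rcases hp.eq_or h with rfl | rfl | h1
  · exact absurd (isVertexOf_right h.symm) hp'
  · exact absurd (isVertexOf_left h.symm) hp'
  · exact h1

theorem IsVertexOf.isLatticeEdge {p q c : ℤ × ℤ} (hp : IsVertexOf p c) (hq : IsVertexOf q c)
    (hne : p ≠ q) : IsLatticeEdge p q := by
  obtain ⟨r, hr, rfl⟩ := hp
  rcases hq.eq_or hr with rfl | rfl | rfl
  · exact absurd rfl hne
  · exact hr
  · exact hr.apex_left.symm

namespace LatticeArc

variable {A B : ℤ × ℤ}

theorem isVertexOf_label_zero (γ : LatticeArc A B) (h : 0 < γ.numCrossings) :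
    IsVertexOf A (γ.label 0) := by
  rw [γ.label_of_lt h]
  convert isVertexOf_apex (γ.isLatticeEdge 0 h).symm
  exact γ.start_eq_apex h

theorem isVertexOf_label_last (γ : LatticeArc A B) (h : 0 < γ.numCrossings) :
    IsVertexOf B (γ.label γ.numCrossings) := by
  obtain ⟨m, hm⟩ : ∃ m, m + 1 = γ.numCrossings := ⟨γ.numCrossings - 1, by omega⟩
  rw [← hm, γ.label_succ (by omega)]
  convert isVertexOf_apex (γ.isLatticeEdge m (by omega))
  exact γ.end_eq_apex hm

/-- An arc that returns to a triangle with the vertex `A` can be shortened. -/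
theorem exists_shorter_of_return_to_start (γ : LatticeArc A B) (hAB : A ≠ B) {j : ℕ} (hj : 0 < j)
    (hjn : j ≤ γ.numCrossings) (hv : IsVertexOf A (γ.label j)) :
    ∃ δ : LatticeArc A B, ∀ k, δ.markovLength k < γ.markovLength k := by
  classical
  -- The new arc starts in the last triangle visited that has the vertex `A`.
  set m := Nat.findGreatest (fun m => IsVertexOf A (γ.label m)) γ.numCrossings with hm
  have hmn : m ≤ γ.numCrossings := Nat.findGreatest_le _
  have hm0 : 0 < m := hj.trans_le (Nat.le_findGreatest hjn hv)
  have hmv : IsVertexOf A (γ.label m) :=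
    Nat.findGreatest_spec (P := fun m => IsVertexOf A (γ.label m)) hjn hv
  refine γ.exists_shortcut hm0 hmn (fun h => absurd h (lt_irrefl 0)) (fun _ h => ?_)
    (fun h => absurd h (lt_irrefl 0)) (fun _ h => ?_)
  · have hnot : ¬ IsVertexOf A (γ.label (m + 1)) :=
      Nat.findGreatest_is_greatest (P := fun m => IsVertexOf A (γ.label m)) (Nat.lt_succ_self m) h
    rw [γ.label_of_lt h] at hmv
    rw [γ.label_succ h] at hnot
    exact hmv.eq_apex (γ.isLatticeEdge m h).symm hnot
  · rw [h] at hmv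
    exact hmv.isLatticeEdge (γ.isVertexOf_label_last (by omega)) hAB

/-- An arc that visits a triangle with the vertex `B` early can be shortened. -/
theorem exists_shorter_of_early_end (γ : LatticeArc A B) (hAB : A ≠ B) {i : ℕ}
    (hi : i < γ.numCrossings) (hv : IsVertexOf B (γ.label i)) :
    ∃ δ : LatticeArc A B, ∀ k, δ.markovLength k < γ.markovLength k := by
  classical
  have hex : ∃ m, IsVertexOf B (γ.label m) := ⟨i, hv⟩
  -- The new arc ends in the first triangle visited that has the vertex `B`.
  set m := Nat.find hex with hm
  have hmn : m < γ.numCrossings := (Nat.find_min' hex hv).trans_lt hi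
  have hmv : IsVertexOf B (γ.label m) := Nat.find_spec hex
  refine γ.exists_shortcut hmn le_rfl (fun _ h => absurd h (lt_irrefl _))
    (fun _ h => absurd h (lt_irrefl _)) (fun h _ => ?_) (fun h _ => ?_)
  · obtain ⟨p, hp⟩ : ∃ p, m = p + 1 := ⟨m - 1, by omega⟩
    have hnot : ¬ IsVertexOf B (γ.label p) := Nat.find_min hex (by omega)
    rw [hp, γ.label_succ (by omega)] at hmv
    rw [γ.label_of_lt (by omega)] at hnot
    rw [hp, Nat.add_sub_cancel]
    exact hmv.eq_apex (γ.isLatticeEdge p (by omega)) hnot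
  · rw [h] at hmv
    exact (γ.isVertexOf_label_zero (by omega)).isLatticeEdge hmv hAB

/-- An arc between different points that visits a triangle twice can be shortened: the part in
between is left out, together with as much as possible of what precedes and follows it. -/
theorem exists_shorter_of_label_eq (γ : LatticeArc A B) (hAB : A ≠ B) {i j : ℕ} (hij : i < j)
    (hj : j ≤ γ.numCrossings) (h : γ.label i = γ.label j) :
    ∃ δ : LatticeArc A B, ∀ k, δ.markovLength k < γ.markovLength k := by
  induction i generalizing j with
  | zero =>
    exact γ.exists_shorter_of_return_to_start hAB hij hj
      (h ▸ γ.isVertexOf_label_zero (by omega))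
  | succ i ih =>
    rcases hj.eq_or_lt with rfl | hj'
    · exact γ.exists_shorter_of_early_end hAB hij (h ▸ γ.isVertexOf_label_last (by omega))
    by_cases hback : γ.label i = γ.label (j + 1)
    · exact ih (by omega) hj' hback
    refine γ.exists_shortcut hij hj (fun _ _ => ?_) (fun h => by omega) (fun _ h => by omega)
      (fun h => by omega)
    have hi : i < γ.numCrossings := by omega
    rw [Nat.add_sub_cancel]
    rw [γ.label_of_lt hi, γ.label_succ hj'] at hback
    rw [γ.label_succ hi, γ.label_of_lt hj'] at h
    rcases eq_of_triSum_eq (γ.isLatticeEdge i hi) (γ.isLatticeEdge j hj').symm h.symm with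
      ⟨e1, e2⟩ | ⟨e1, e2⟩ | ⟨e1, e2⟩
    · rw [e1, e2] at hback
      exact absurd rfl hback
    · exact Or.inr ⟨e2, e1⟩
    · exact Or.inl ⟨e2, e1⟩

end LatticeArc

/-! ### The Markov distance -/

theorem isLeast_markovDistance {k : ℕ} {A B : ℤ × ℤ} (hAB : A ≠ B)
    (hne : (markovLengths k A B).Nonempty) :
    IsLeast (markovLengths k A B) (markovDistance k A B) := by
  classical
  have hnat : ∀ x ∈ markovLengths k A B, ∃ m : ℕ, (m : ℝ) = x := by
    rintro _ (⟨δ, rfl⟩ | ⟨δ, rfl⟩) <;> exact δ.exists_natCast_eq_markovLength k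
  have hex : ∃ m : ℕ, (m : ℝ) ∈ markovLengths k A B := by
    obtain ⟨x, hx⟩ := hne
    obtain ⟨m, rfl⟩ := hnat x hx
    exact ⟨m, hx⟩
  have hleast : IsLeast (markovLengths k A B) (Nat.find hex : ℝ) := by
    refine ⟨Nat.find_spec hex, fun x hx => ?_⟩
    obtain ⟨m, rfl⟩ := hnat x hx
    exact_mod_cast Nat.find_min' hex hx
  rw [markovDistance, if_neg hAB, hleast.csInf_eq]
  exact hleast

theorem mainTheorem6 (k : ℕ) (A B : ℤ × ℤ) (γ : LatticeArc A B)
    (hγ : γ.HasNoncontractibleSelfIntersection) :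
    (A ≠ B → IsLeast (markovLengths k A B) (markovDistance k A B)) ∧
      markovDistance k A B < γ.markovLength k := by
  have hleast : A ≠ B → IsLeast (markovLengths k A B) (markovDistance k A B) := fun hAB =>
    isLeast_markovDistance hAB ⟨_, Or.inl ⟨γ, rfl⟩⟩
  refine ⟨hleast, ?_⟩
  by_cases hAB : A = B
  · rw [markovDistance, if_pos hAB]
    exact γ.markovLength_pos k
  · obtain ⟨i, j, hij, hj, h⟩ := γ.exists_label_eq hγ
    obtain ⟨δ, hδ⟩ := γ.exists_shorter_of_label_eq hAB hij hj h
    exact ((hleast hAB).2 (Or.inl ⟨δ, rfl⟩)).trans_lt (hδ k)
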